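/- Let $m,n,l\ge 1$ be integers and $\Theta\in\mathbb{R}^{l\times n}$. For agents $i=1,\dots,m$ and times $t=1,2,\dots$ let $$y_{i,t}=\Theta x_{i,t}+\eta_{i,t},\qquad x_{i,t}\sim\mathcal N(\mu_{i,t},\sigma_x^2I_n),\qquad \eta_{i,t}\sim\mathcal N(0,\sigma_\eta^2I_l),$$ where the random vectors $x_{i,t},\eta_{i,t}$ (over all $i$ and $t$) are mutually independent, $\sigma_x>0$, $\sigma_\eta\ge 0$, and the means $\mu_{i,t}\in\mathbb{R}^n$ are deterministic with $\hat\mu=\sup_{i,t}\|\mu_{i,t}\|<\infty$. Fix $\delta>0$ and put $$t_1=8n+16\log\tfrac{2}{\delta},\qquad t_2=\Big(\tfrac{16\hat\mu(\sqrt{4n}+\sqrt{2\log\frac{2}{\delta}})}{\sigma_x}\Big)^2,\qquad t_3=2(n+l)\log\tfrac{1}{\delta},$$ $$C_1=8\sigma_\eta\Big(4\sigma_x\sqrt{(n+l)\log\tfrac{9}{\delta}}+\hat\mu\big(\sqrt{2(l+n)}+2\sqrt{\log\tfrac{2}{\delta}}\big)\Big).$$ Let $t\ge 1$ be an integer with $t\ge\frac1m\max(t_1,t_2,t_3)$,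 and let $\bar\mu_t=\frac{4}{mt\sigma_x^2}\sum_{i=1}^m\sum_{j=1}^t\mu_{i,j}\mu_{i,j}^*$. Then, with probability at least $1-4\delta$, the matrix $\sum_{i=1}^m\sum_{j=1}^t x_{i,j}x_{i,j}^*$ is invertible and the centralized least-squares estimate $$\hat\Theta_{t+1}=\Big(\sum_{i=1}^m\sum_{j=1}^t y_{i,j}x_{i,j}^*\Big)\Big(\sum_{i=1}^m\sum_{j=1}^t x_{i,j}x_{i,j}^*\Big)^{-1}$$ satisfies $$\|\hat\Theta_{t+1}-\Theta\|\le\frac{C_1}{\sqrt{mt}\,\sigma_x^2\,\lambda_{\min}(I_n+\bar\mu_t)},$$ where $\|\cdot\|$ is the spectral norm (the Euclidean norm for vectors) and $\lambda_{\min}$ the smallest eigenvalue. (When $\delta\ge 1/4$ the claim is vacuous; the logarithms are positive otherwise.) -/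

import Mathlib

open MeasureTheory ProbabilityTheory
open scoped Matrix.Norms.L2Operator

noncomputable section

namespace DistEst

/-- The double sum `∑ᵢ ∑_{j=1}^t u_{i,j} v_{i,j}*` over all agents `i` and all
time steps `1, …, t`. -/
def crossSum {m p q : ℕ} (u : Fin m → ℕ+ → EuclideanSpace ℝ (Fin p))
    (v : Fin m → ℕ+ → EuclideanSpace ℝ (Fin q)) (t : ℕ+) : Matrix (Fin p) (Fin q) ℝ :=
  ∑ i, ∑ j ∈ Finset.Icc 1 t, Matrix.vecMulVec (u i j).ofLp (v i j).ofLp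

/-- The centralized least-squares estimate computed from the samples `(x_{i,j}, y_{i,j})` of all
agents up to time `t`, namely `(∑ y x*) (∑ x x*)⁻¹`. -/
def globalEstimate {m n l : ℕ} (x : Fin m → ℕ+ → EuclideanSpace ℝ (Fin n))
    (y : Fin m → ℕ+ → EuclideanSpace ℝ (Fin l)) (t : ℕ+) : Matrix (Fin l) (Fin n) ℝ :=
  crossSum y x t * (crossSum x x t)⁻¹

/-- The smallest eigenvalue of a real symmetric matrix. For a positive semidefinite matrix, the only
case used here, it is also the eigenvalue of smallest magnitude. -/
def lambdaMin {n : ℕ} (A : Matrix (Fin n) (Fin n) ℝ) : ℝ := sInf (spectrum ℝ A)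

/-- The matrix `μ̄_t = 4 / (m t σ_x²) ∑ᵢ ∑_{j=1}^t μ_{i,j} μ_{i,j}*`. -/
def meanGram {m n : ℕ} (μ : Fin m → ℕ+ → EuclideanSpace ℝ (Fin n)) (σx : ℝ) (t : ℕ+) :
    Matrix (Fin n) (Fin n) ℝ :=
  (4 / ((m : ℝ) * (t : ℝ) * σx ^ 2)) • crossSum μ μ t

/-- The threshold `t₁`. -/
def t1 (n : ℕ) (δ : ℝ) : ℝ := 8 * n + 16 * Real.log (2 / δ)

/-- The threshold `t₂`. -/
def t2 (n : ℕ) (σx μhat δ : ℝ) : ℝ :=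
  (16 * μhat * (√(4 * n) + √(2 * Real.log (2 / δ))) / σx) ^ 2

/-- The threshold `t₃`. -/
def t3 (n l : ℕ) (δ : ℝ) : ℝ := 2 * ((n : ℝ) + l) * Real.log (1 / δ)

/-- The constant `C₁`. -/
def C1 (n l : ℕ) (σx ση μhat δ : ℝ) : ℝ :=
  8 * ση * (4 * σx * √(((n : ℝ) + l) * Real.log (9 / δ))
    + μhat * (√(2 * ((l : ℝ) + n)) + 2 * √(Real.log (2 / δ))))

/-- The data model: `y_{i,t} = Θ x_{i,t} + η_{i,t}` with `x_{i,t} ∼ N(μ_{i,t}, σ_x² I)` and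
`η_{i,t} ∼ N(0, σ_η² I)`, where all the features and all the noises are mutually independent
(the pairs `(x_{i,t}, η_{i,t})` are mutually independent over agents and times, and within each pair
the two members are independent), and `μhat` is the supremum of the norms of the means. -/
structure GaussianModel {Ω : Type*} [MeasurableSpace Ω] (P : Measure Ω) {m n l : ℕ}
    (Θ : Matrix (Fin l) (Fin n) ℝ) (μ : Fin m → ℕ+ → EuclideanSpace ℝ (Fin n))
    (σx ση μhat : ℝ) (x : Fin m → ℕ+ → Ω → EuclideanSpace ℝ (Fin n))
    (η y : Fin m → ℕ+ → Ω → EuclideanSpace ℝ (Fin l)) : Prop where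
  label : ∀ i j ω, y i j ω = Matrix.toEuclideanLin Θ (x i j ω) + η i j ω
  law_feature : ∀ i j, HasLaw (x i j)
    (multivariateGaussian (μ i j) (σx ^ 2 • (1 : Matrix (Fin n) (Fin n) ℝ))) P
  law_noise : ∀ i j, HasLaw (η i j)
    (multivariateGaussian 0 (ση ^ 2 • (1 : Matrix (Fin l) (Fin l) ℝ))) P
  indep_pairs : iIndepFun (fun (k : Fin m × ℕ+) ω => (x k.1 k.2 ω, η k.1 k.2 ω)) P
  indep_feature_noise : ∀ i j, IndepFun (x i j) (η i j) P
  sup_mean : IsLUB (Set.range fun k : Fin m × ℕ+ => ‖μ k.1 k.2‖) μhat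

end DistEst

end

open scoped RealInnerProductSpace

/-! Write `N = m t` and index the samples by pairs `k` of an agent and a time. They are `x_k = μ_k +
σ_x g_k` and `η_k = σ_η h_k`, with `g_k`, `h_k` independent standard Gaussian vectors. With `S = ∑
x_k x_k*` and `E = ∑ η_k x_k*` the estimation error is `E S⁻¹`. It therefore suffices to bound the
quadratic form of `S` below by `c = N σ_x² λ_min / 8` and the bilinear form of `E` above by `r = √N
C₁ / 8`, since `r / c` is the claimed bound (`isUnit_and_norm_sub_le`).

Expanding `S` and `E` in `μ` and `g`, `h` leaves four random quantities: the least value of `∑ ⟪g_k,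
u⟫²` on the unit sphere, the mixed matrices `∑ g_k μ_k*` and `∑ h_k μ_k*`, and the product `∑ h_k
g_k*`. All tails come from Markov's inequality for exponentials. Uniformity in the unit vectors
comes from integrating an exponential over a ball instead of using a net: a bad direction makes the
integrand large on a small ball around it, the expectation of the integral is explicit by Tonelli,
and the ratio of ball volumes costs a factor exponential in the dimension.

For the smallest singular value (`measure_exists_sum_inner_sq_lt`) the integrand `exp (tilt g v)`
has mean one for every `v`. Near a minimizing unit vector it stays large on half a ball, because the
minimizer is an eigenvector; this needs the Frobenius norm of `g` to be under control, which is a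
separate event (`measure_le_sum_normSq`). For the product matrix (`measure_exists_lt_crossForm`) the
integrand is the exponential of the bilinear form, whose ball averages dominate the central value by
convexity. The mixed matrices are bounded in Frobenius norm (`measure_lt_sum_normSq_sum`), by
Gaussian linearization and Jensen.

The five exceptional events have total probability at most `7δ/2`. -/

namespace DistEst

/-! ### Gaussian exponential moments. -/

section

/-- The real exponential, valued in the extended nonnegative reals. -/
noncomputable def eexp (r : ℝ) : ENNReal := ENNReal.ofReal (Real.exp r)

lemma eexp_add (a b : ℝ) : eexp (a + b) = eexp a * eexp b := by
  rw [eexp, Real.exp_add, ENNReal.ofReal_mul (Real.exp_pos a).le]; rfl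

lemma eexp_zero : eexp 0 = 1 := by simp [eexp]

lemma eexp_ne_zero (a : ℝ) : eexp a ≠ 0 := by simp [eexp, Real.exp_pos]

lemma eexp_ne_top (a : ℝ) : eexp a ≠ ⊤ := ENNReal.ofReal_ne_top

lemma eexp_mono {a b : ℝ} (h : a ≤ b) : eexp a ≤ eexp b :=
  ENNReal.ofReal_le_ofReal (Real.exp_le_exp.2 h)

lemma eexp_sum {ι : Type*} (s : Finset ι) (f : ι → ℝ) :
    eexp (∑ i ∈ s, f i) = ∏ i ∈ s, eexp (f i) := by
  rw [eexp, Real.exp_sum, ENNReal.ofReal_prod_of_nonneg fun i _ => (Real.exp_pos _).le]; rfl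

lemma eexp_nat_mul (n : ℕ) (a : ℝ) : eexp (n * a) = eexp a ^ n := by
  rw [eexp, Real.exp_nat_mul, ENNReal.ofReal_pow (Real.exp_pos a).le]; rfl

@[fun_prop]
lemma measurable_eexp : Measurable eexp := by unfold eexp; fun_prop

/-- The exponential Markov inequality. -/
lemma measure_le_eexp_mul_lintegral {Ω : Type*} [MeasurableSpace Ω] (P : Measure Ω) {f : Ω → ℝ}
    (hf : Measurable f) (c : ℝ) :
    P {ω | c ≤ f ω} ≤ eexp (-c) * ∫⁻ ω, eexp (f ω) ∂P := by
  have h := mul_meas_ge_le_lintegral₀ (μ := P) (f := fun ω => eexp (f ω))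
    (measurable_eexp.comp hf).aemeasurable (eexp c)
  have h2 : P {ω | c ≤ f ω} ≤ P {ω | eexp c ≤ eexp (f ω)} :=
    measure_mono fun ω hω => eexp_mono hω
  calc P {ω | c ≤ f ω} = eexp (-c) * (eexp c * P {ω | c ≤ f ω}) := by
        rw [← mul_assoc, ← eexp_add]; simp [eexp_zero]
    _ ≤ _ := by gcongr; exact le_trans (by gcongr) h

variable {d : ℕ}

lemma stdGaussian_map_inner (v : EuclideanSpace ℝ (Fin d)) :
    (stdGaussian (EuclideanSpace ℝ (Fin d))).map (fun x => ⟪v, x⟫)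
      = (gaussianReal 0 1).map (fun x => ‖v‖ * x) := by
  rw [gaussianReal_map_const_mul]
  refine Measure.ext_of_charFun ?_
  ext s
  have h1 : charFun ((stdGaussian (EuclideanSpace ℝ (Fin d))).map (fun x => ⟪v, x⟫)) s
      = charFun (stdGaussian (EuclideanSpace ℝ (Fin d))) (s • v) := by
    rw [charFun_apply, charFun_apply, integral_map (by fun_prop) (by fun_prop)]
    congr 1; ext x
    simp [inner_smul_right, real_inner_comm]
  rw [h1, charFun_stdGaussian, charFun_gaussianReal, norm_smul]
  congr 1
  simp [mul_pow]
  norm_cast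
  rw [sq_abs]; ring

lemma lintegral_eexp_mul_gaussianReal (c : ℝ) :
    ∫⁻ x, eexp (c * x) ∂(gaussianReal 0 1) = eexp (c ^ 2 / 2) := by
  have h : ∫ x, Real.exp (c * x) ∂(gaussianReal 0 1) = Real.exp (c ^ 2 / 2) := by
    have := congrFun (mgf_fun_id_gaussianReal (μ := 0) (v := 1)) c
    simpa [mgf] using this
  unfold eexp
  rw [← ofReal_integral_eq_lintegral_ofReal (integrable_exp_mul_gaussianReal c)
    (Filter.Eventually.of_forall fun x => (Real.exp_pos _).le), h]

lemma lintegral_eexp_sq_gaussianReal {b : ℝ} (hb : 2 * b < 1) :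
    ∫⁻ x, eexp (b * x ^ 2) ∂(gaussianReal 0 1) = eexp (-(Real.log (1 - 2 * b) / 2)) := by
  rw [gaussianReal_of_var_ne_zero 0 one_ne_zero,
    lintegral_withDensity_eq_lintegral_mul _ (measurable_gaussianPDF 0 1) (by fun_prop)]
  have h1 : ∀ x : ℝ, (gaussianPDF 0 1 * fun x => eexp (b * x ^ 2)) x
      = ENNReal.ofReal ((√(2 * Real.pi))⁻¹ * Real.exp (-((1 - 2 * b) / 2) * x ^ 2)) := by
    intro x
    simp only [Pi.mul_apply, gaussianPDF, gaussianPDFReal, eexp]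
    rw [← ENNReal.ofReal_mul (by positivity), mul_assoc, ← Real.exp_add]
    congr 3
    · simp
    · simp; ring
  simp_rw [h1]
  rw [← ofReal_integral_eq_lintegral_ofReal
    ((integrable_exp_neg_mul_sq (by linarith)).const_mul _)
    (Filter.Eventually.of_forall fun x => by positivity), integral_const_mul, integral_gaussian,
    eexp]
  congr 1
  have hp : 0 < 1 - 2 * b := by linarith
  rw [show Real.pi / ((1 - 2 * b) / 2) = (2 * Real.pi) * (1 - 2 * b)⁻¹ by field_simp,
    Real.sqrt_mul (x := 2 * Real.pi) (by positivity) (1 - 2 * b)⁻¹, ← mul_assoc, inv_mul_cancel₀ (by positivity), one_mul,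
    Real.exp_neg, Real.sqrt_inv, Real.exp_half, Real.exp_log hp]

lemma lintegral_eexp_inner_stdGaussian (v : EuclideanSpace ℝ (Fin d)) :
    ∫⁻ x, eexp ⟪v, x⟫ ∂(stdGaussian (EuclideanSpace ℝ (Fin d))) = eexp (‖v‖ ^ 2 / 2) := by
  rw [← lintegral_map (f := eexp) (g := fun x => ⟪v, x⟫) (by fun_prop) (by fun_prop),
    stdGaussian_map_inner, lintegral_map (by fun_prop) (by fun_prop),
    lintegral_eexp_mul_gaussianReal]

lemma lintegral_eexp_inner_sq_stdGaussian (v : EuclideanSpace ℝ (Fin d)) {b : ℝ}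
    (hb : 2 * b * ‖v‖ ^ 2 < 1) :
    ∫⁻ x, eexp (b * ⟪v, x⟫ ^ 2) ∂(stdGaussian (EuclideanSpace ℝ (Fin d)))
      = eexp (-(Real.log (1 - 2 * b * ‖v‖ ^ 2) / 2)) := by
  rw [← lintegral_map (f := fun y => eexp (b * y ^ 2)) (g := fun x => ⟪v, x⟫) (by fun_prop)
    (by fun_prop), stdGaussian_map_inner, lintegral_map (by fun_prop) (by fun_prop)]
  simp_rw [mul_pow, ← mul_assoc]
  rw [lintegral_eexp_sq_gaussianReal (by linarith), mul_assoc 2 b]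

lemma lintegral_pi_prod {ι : Type*} [Fintype ι] {X : ι → Type*} [∀ i, MeasurableSpace (X i)]
    (μ : ∀ i, Measure (X i)) [∀ i, IsProbabilityMeasure (μ i)] (f : ∀ i, X i → ENNReal)
    (hf : ∀ i, Measurable (f i)) :
    ∫⁻ ω, ∏ i, f i (ω i) ∂(Measure.pi μ) = ∏ i, ∫⁻ x, f i x ∂(μ i) := by
  refine (lintegral_prod_eq_prod_lintegral_of_indepFun Finset.univ
    (fun i (ω : ∀ i, X i) => f i (ω i))
    (iIndepFun_pi fun i => (hf i).aemeasurable)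
    (fun i => (hf i).comp (measurable_pi_apply i))).trans ?_
  refine Finset.prod_congr rfl fun i _ => ?_
  exact (measurePreserving_eval μ i).lintegral_comp (hf i)

lemma lintegral_eexp_normSq_stdGaussian {b : ℝ} (hb : 2 * b < 1) :
    ∫⁻ x, eexp (b * ‖x‖ ^ 2) ∂(stdGaussian (EuclideanSpace ℝ (Fin d)))
      = eexp (-(d * Real.log (1 - 2 * b) / 2)) := by
  rw [← map_pi_eq_stdGaussian, lintegral_map (by fun_prop) (by fun_prop)]
  simp_rw [EuclideanSpace.real_norm_sq_eq, Finset.mul_sum, eexp_sum]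
  rw [lintegral_pi_prod (fun _ => gaussianReal 0 1) (fun _ x => eexp (b * x ^ 2))
    (fun _ => by fun_prop)]
  simp_rw [lintegral_eexp_sq_gaussianReal hb, Finset.prod_const, ← eexp_nat_mul]
  congr 1
  simp; ring

end

/-! ### Averages over Euclidean balls. -/

section

variable {d : ℕ}

lemma setLIntegral_ball_eq_add (f : EuclideanSpace ℝ (Fin d) → ENNReal)
    (c : EuclideanSpace ℝ (Fin d)) (r : ℝ) :
    ∫⁻ v in Metric.ball c r, f v = ∫⁻ z in Metric.ball 0 r, f (c + z) := by
  have h := (measurePreserving_add_left (volume : Measure (EuclideanSpace ℝ (Fin d)))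
    c).setLIntegral_comp_preimage_emb (measurableEmbedding_addLeft c) f (Metric.ball c r)
  rw [← h]
  congr 2
  ext z; simp

lemma setLIntegral_neg (f : EuclideanSpace ℝ (Fin d) → ENNReal)
    (s : Set (EuclideanSpace ℝ (Fin d))) :
    ∫⁻ z in s, f z = ∫⁻ z in -s, f (-z) := by
  have h := (Measure.measurePreserving_neg (volume : Measure (EuclideanSpace ℝ
    (Fin d)))).setLIntegral_comp_preimage_emb (MeasurableEquiv.neg _).measurableEmbedding f s
  rw [← h]; rfl

lemma neg_ball_zero (r : ℝ) :
    -(Metric.ball (0 : EuclideanSpace ℝ (Fin d)) r) = Metric.ball 0 r := by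
  ext z; simp

lemma two_mul_eexp_le (x y : ℝ) : 2 * eexp x ≤ eexp (x + y) + eexp (x - y) := by
  have h : 2 * Real.exp x ≤ Real.exp (x + y) + Real.exp (x - y) := by
    have h1 := Real.one_le_cosh y
    rw [Real.cosh_eq] at h1
    rw [sub_eq_add_neg, Real.exp_add, Real.exp_add]
    nlinarith [Real.exp_pos x]
  unfold eexp
  rw [← ENNReal.ofReal_add (Real.exp_pos _).le (Real.exp_pos _).le,
    show (2 : ENNReal) = ENNReal.ofReal 2 by simp, ← ENNReal.ofReal_mul (by norm_num)]
  exact ENNReal.ofReal_le_ofReal h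

/-- The average over a ball of the exponential of a linear form is at least its value at the
centre. -/
lemma volume_ball_mul_eexp_le (a c : EuclideanSpace ℝ (Fin d)) (r : ℝ) :
    volume (Metric.ball (0 : EuclideanSpace ℝ (Fin d)) r) * eexp ⟪a, c⟫
      ≤ ∫⁻ v in Metric.ball c r, eexp ⟪a, v⟫ := by
  rw [setLIntegral_ball_eq_add]
  set I := ∫⁻ z in Metric.ball 0 r, eexp ⟪a, c + z⟫ with hI
  -- Symmetrizing under `z ↦ -z` lets `cosh ≥ 1` replace Jensen's inequality.
  have h1 : I = ∫⁻ z in Metric.ball 0 r, eexp ⟪a, c - z⟫ := by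
    rw [hI, setLIntegral_neg, neg_ball_zero]; simp [sub_eq_add_neg]
  have h2 : 2 * (volume (Metric.ball (0 : EuclideanSpace ℝ (Fin d)) r) * eexp ⟪a, c⟫) ≤ 2 * I := by
    calc _ = ∫⁻ z in Metric.ball (0 : EuclideanSpace ℝ (Fin d)) r, 2 * eexp ⟪a, c⟫ := by
          rw [setLIntegral_const]; ring
      _ ≤ ∫⁻ z in Metric.ball (0 : EuclideanSpace ℝ (Fin d)) r,
            (eexp ⟪a, c + z⟫ + eexp ⟪a, c - z⟫) := by
          refine lintegral_mono fun z => ?_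
          rw [inner_add_right, inner_sub_right]
          exact two_mul_eexp_le _ _
      _ = 2 * I := by
          rw [lintegral_add_left (by fun_prop), ← h1, two_mul]
  exact (ENNReal.mul_le_mul_iff_right (by simp) (by simp)).1 h2

/-- For an even function, half of the integral over a ball is carried by each half ball. -/
lemma setLIntegral_ball_le_two_mul {f : EuclideanSpace ℝ (Fin d) → ENNReal}
    (hf : ∀ z, f (-z) = f z) (u : EuclideanSpace ℝ (Fin d)) (r : ℝ) :
    ∫⁻ z in Metric.ball 0 r, f z ≤ 2 * ∫⁻ z in Metric.ball 0 r ∩ {z | 0 ≤ ⟪u, z⟫}, f z := by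
  set D := Metric.ball (0 : EuclideanSpace ℝ (Fin d)) r ∩ {z | 0 ≤ ⟪u, z⟫}
  have h1 : Metric.ball (0 : EuclideanSpace ℝ (Fin d)) r ⊆ D ∪ -D := by
    intro z hz
    rcases le_total 0 ⟪u, z⟫ with h | h
    · exact Or.inl ⟨hz, h⟩
    · exact Or.inr ⟨by simpa using hz, by simpa [inner_neg_right] using h⟩
  have h2 : ∫⁻ z in -D, f z = ∫⁻ z in D, f z := by
    rw [setLIntegral_neg, neg_neg]; simp [hf]
  calc _ ≤ ∫⁻ z in D ∪ -D, f z := lintegral_mono_set h1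
    _ ≤ (∫⁻ z in D, f z) + ∫⁻ z in -D, f z := lintegral_union_le _ _ _
    _ = _ := by rw [h2, two_mul]

lemma integrableOn_ball {f : EuclideanSpace ℝ (Fin d) → ℝ} (hf : Continuous f) (r : ℝ) :
    IntegrableOn f (Metric.ball 0 r) :=
  (hf.continuousOn.integrableOn_compact (isCompact_closedBall 0 r)).mono_set
    Metric.ball_subset_closedBall

/-- The reflection exchanging `g` and `h` preserves both the ball and Lebesgue measure. -/
lemma integral_ball_inner_sq_eq {g h : EuclideanSpace ℝ (Fin d)} (hgh : ‖g‖ = ‖h‖) (r : ℝ) :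
    ∫ z in Metric.ball 0 r, ⟪g, z⟫ ^ 2 = ∫ z in Metric.ball 0 r, ⟪h, z⟫ ^ 2 := by
  set A := (ℝ ∙ (g - h))ᗮ.reflection
  have hA : A g = h := Submodule.reflection_sub hgh
  have h1 := A.measurePreserving.setIntegral_preimage_emb
    A.toHomeomorph.measurableEmbedding (fun z => ⟪h, z⟫ ^ 2) (Metric.ball 0 r)
  rw [← h1, ← hA]
  have h2 : A ⁻¹' Metric.ball 0 r = Metric.ball 0 r := by
    ext z; simp
  rw [h2]
  simp

/-- By isotropy `g` may be turned into `‖g‖ e_i` for each `i`; summing over `i` produces `‖z‖²`,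
which is at most `r²` on the ball. The gain of the factor `1/d` is what makes a bound on the
Frobenius norm of order `d N` affordable later. -/
lemma integral_ball_inner_sq_le (g : EuclideanSpace ℝ (Fin d)) {r : ℝ} :
    d * ∫ z in Metric.ball 0 r, ⟪g, z⟫ ^ 2
      ≤ ‖g‖ ^ 2 * r ^ 2 * volume.real (Metric.ball (0 : EuclideanSpace ℝ (Fin d)) r) := by
  have h1 : ∀ i : Fin d, ∫ z in Metric.ball 0 r, ⟪g, z⟫ ^ 2
      = ∫ z in Metric.ball (0 : EuclideanSpace ℝ (Fin d)) r, ‖g‖ ^ 2 * (z i) ^ 2 := by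
    intro i
    rw [integral_ball_inner_sq_eq (h := ‖g‖ • EuclideanSpace.single i 1) (by simp [norm_smul])]
    congr 1; ext z
    rw [inner_smul_left, EuclideanSpace.inner_single_left]
    simp [mul_pow]
  calc d * ∫ z in Metric.ball 0 r, ⟪g, z⟫ ^ 2
      = ∑ i : Fin d, ∫ z in Metric.ball (0 : EuclideanSpace ℝ (Fin d)) r,
          ‖g‖ ^ 2 * (z i) ^ 2 := by
        rw [← Finset.sum_congr rfl fun i _ => h1 i]; simp
    _ = ∫ z in Metric.ball (0 : EuclideanSpace ℝ (Fin d)) r, ‖g‖ ^ 2 * ‖z‖ ^ 2 := by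
        rw [← integral_finsetSum _ fun i _ => integrableOn_ball (by fun_prop) r]
        simp_rw [EuclideanSpace.real_norm_sq_eq, Finset.mul_sum]
    _ ≤ ∫ z in Metric.ball (0 : EuclideanSpace ℝ (Fin d)) r, ‖g‖ ^ 2 * r ^ 2 := by
        refine setIntegral_mono_on (integrableOn_ball (by fun_prop) r)
          (integrableOn_ball (by fun_prop) r) Metric.isOpen_ball.measurableSet fun z hz => ?_
        have : ‖z‖ < r := by simpa using hz
        gcongr
    _ = _ := by rw [setIntegral_const]; simp; ring

/-- Jensen's inequality: the average of `exp (-c Q)` over the ball is at least `exp` of `-c` times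
the average of `Q`, and that average is at most `r² T` by isotropy. -/
lemma volume_ball_mul_eexp_neg_le {K : Type*} [Fintype K] (g : K → EuclideanSpace ℝ (Fin d))
    (hd : 0 < d) {c r T : ℝ} (hc : 0 ≤ c) (hT : ∑ k, ‖g k‖ ^ 2 ≤ d * T) :
    volume (Metric.ball (0 : EuclideanSpace ℝ (Fin d)) r) * eexp (-(c * (r ^ 2 * T)))
      ≤ ∫⁻ z in Metric.ball 0 r, eexp (-(c * ∑ k, ⟪g k, z⟫ ^ 2)) := by
  have hd' : (0 : ℝ) < d := by exact_mod_cast hd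
  set V := volume.real (Metric.ball (0 : EuclideanSpace ℝ (Fin d)) r)
  have hV : 0 ≤ V := measureReal_nonneg
  have hQ : ∫ z in Metric.ball 0 r, ∑ k, ⟪g k, z⟫ ^ 2 ≤ r ^ 2 * T * V := by
    rw [integral_finsetSum _ fun i _ => integrableOn_ball (by fun_prop) r]
    refine le_of_mul_le_mul_left ?_ hd'
    rw [Finset.mul_sum]
    calc _ ≤ ∑ k, ‖g k‖ ^ 2 * r ^ 2 * V :=
          Finset.sum_le_sum fun k _ => integral_ball_inner_sq_le (g k)
      _ = (∑ k, ‖g k‖ ^ 2) * (r ^ 2 * V) := by rw [Finset.sum_mul]; simp [mul_assoc]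
      _ ≤ (d * T) * (r ^ 2 * V) := by gcongr
      _ = _ := by ring
  set x₀ := c * (r ^ 2 * T)
  -- Jensen in the form of the tangent line to `exp` at `-x₀`.
  have hreal : Real.exp (-x₀) * V
      ≤ ∫ z in Metric.ball 0 r, Real.exp (-(c * ∑ k, ⟪g k, z⟫ ^ 2)) := by
    calc Real.exp (-x₀) * V ≤ Real.exp (-x₀) * ((1 + x₀) * V
          - c * ∫ z in Metric.ball 0 r, ∑ k, ⟪g k, z⟫ ^ 2) := by
          gcongr
          nlinarith [mul_le_mul_of_nonneg_left hQ hc]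
      _ = ∫ z in Metric.ball 0 r, Real.exp (-x₀) * ((1 + x₀) - c * ∑ k, ⟪g k, z⟫ ^ 2) := by
          rw [integral_const_mul, integral_sub (integrableOn_ball (by fun_prop) r)
            (integrableOn_ball (by fun_prop) r), integral_const_mul, setIntegral_const]
          simp [V, mul_comm]
      _ ≤ _ := by
          refine integral_mono (integrableOn_ball (by fun_prop) r)
            (integrableOn_ball (by fun_prop) r) fun z => ?_
          have := Real.add_one_le_exp (x₀ - c * ∑ k, ⟪g k, z⟫ ^ 2)
          calc _ ≤ Real.exp (-x₀) * Real.exp (x₀ - c * ∑ k, ⟪g k, z⟫ ^ 2) := by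
                gcongr; linarith
            _ = _ := by rw [← Real.exp_add]; congr 1; ring
  unfold eexp
  rw [← ofReal_integral_eq_lintegral_ofReal (integrableOn_ball (by fun_prop) r)
    (Filter.Eventually.of_forall fun z => (Real.exp_pos _).le)]
  refine le_trans (le_of_eq ?_) (ENNReal.ofReal_le_ofReal hreal)
  rw [ENNReal.ofReal_mul (Real.exp_pos _).le, mul_comm]
  congr 1
  exact (ENNReal.ofReal_toReal measure_ball_lt_top.ne).symm

end

/-! ### Smallest singular value and Frobenius norm of a Gaussian matrix. -/

section

variable {d : ℕ} {K : Type*} [Fintype K]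

lemma sum_inner_add_sq (g : K → EuclideanSpace ℝ (Fin d)) (u z : EuclideanSpace ℝ (Fin d)) :
    ∑ k, ⟪g k, u + z⟫ ^ 2
      = ∑ k, ⟪g k, u⟫ ^ 2 + 2 * ∑ k, ⟪g k, u⟫ * ⟪g k, z⟫ + ∑ k, ⟪g k, z⟫ ^ 2 := by
  simp_rw [inner_add_right, Finset.mul_sum, ← Finset.sum_add_distrib]
  refine Finset.sum_congr rfl fun k _ => by ring

/-- A minimizer of a quadratic form on the unit sphere is an eigenvector. -/
lemma sum_inner_mul_inner_eq_of_isMinOn (g : K → EuclideanSpace ℝ (Fin d))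
    {u : EuclideanSpace ℝ (Fin d)} (hu : ‖u‖ = 1)
    (hmin : ∀ v : EuclideanSpace ℝ (Fin d), ‖v‖ = 1 → ∑ k, ⟪g k, u⟫ ^ 2 ≤ ∑ k, ⟪g k, v⟫ ^ 2)
    (z : EuclideanSpace ℝ (Fin d)) :
    ∑ k, ⟪g k, u⟫ * ⟪g k, z⟫ = (∑ k, ⟪g k, u⟫ ^ 2) * ⟪u, z⟫ := by
  set q := ∑ k, ⟪g k, u⟫ ^ 2
  have hq : ∀ v, q * ‖v‖ ^ 2 ≤ ∑ k, ⟪g k, v⟫ ^ 2 := by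
    intro v
    rcases eq_or_ne v 0 with rfl | hv
    · simp
    have hv' : 0 < ‖v‖ := norm_pos_iff.2 hv
    have h1 := hmin (‖v‖⁻¹ • v) (by rw [norm_smul]; simp [hv'.ne'])
    simp_rw [inner_smul_right, mul_pow, ← Finset.mul_sum] at h1
    calc q * ‖v‖ ^ 2 ≤ ((‖v‖⁻¹) ^ 2 * ∑ k, ⟪g k, v⟫ ^ 2) * ‖v‖ ^ 2 := by gcongr
      _ = _ := by field_simp
  -- Perturbing to `u + s z` gives a nonnegative quadratic in `s` with zero constant term, so its
  -- linear coefficient must vanish.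
  have key : ∀ s : ℝ, 0 ≤ (∑ k, ⟪g k, z⟫ ^ 2 - q * ‖z‖ ^ 2) * (s * s)
      + 2 * (∑ k, ⟪g k, u⟫ * ⟪g k, z⟫ - q * ⟪u, z⟫) * s + 0 := by
    intro s
    have h1 := hq (u + s • z)
    rw [sum_inner_add_sq, norm_add_sq_real, hu, norm_smul] at h1
    simp_rw [inner_smul_right, mul_pow, mul_left_comm _ s, ← Finset.mul_sum] at h1
    rw [Real.norm_eq_abs, sq_abs] at h1
    linarith
  have h2 := discrim_le_zero key
  rw [discrim] at h2
  nlinarith [sq_nonneg (∑ k, ⟪g k, u⟫ * ⟪g k, z⟫ - q * ⟪u, z⟫)]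

/-- The exponent of the density used to bound the smallest singular value from below. -/
noncomputable def tilt (g : K → EuclideanSpace ℝ (Fin d)) (v : EuclideanSpace ℝ (Fin d)) : ℝ :=
  -(7 / 6 * ∑ k, ⟪g k, v⟫ ^ 2) + Fintype.card K * (Real.log (1 + 7 / 3 * ‖v‖ ^ 2) / 2)

lemma measurable_tilt : Measurable (fun p : (K → EuclideanSpace ℝ (Fin d)) ×
    EuclideanSpace ℝ (Fin d) => tilt p.1 p.2) := by
  unfold tilt; fun_prop

/-- As `u` is an eigenvector, moving from `u` to `u + z` costs only `2 q ⟪u, z⟫` besides the form at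
`z` itself. On the half ball `⟪u, z⟫ ≥ 0` the growth of the logarithmic normalizer pays for this. -/
lemma le_tilt_add {N q : ℝ} (hN : N = Fintype.card K) (g : K → EuclideanSpace ℝ (Fin d))
    {u z : EuclideanSpace ℝ (Fin d)} (hu : ‖u‖ = 1) (hq : ∑ k, ⟪g k, u⟫ ^ 2 = q)
    (hqN : q ≤ 253 / 1000 * N)
    (heig : ∑ k, ⟪g k, u⟫ * ⟪g k, z⟫ = q * ⟪u, z⟫) (hz : ‖z‖ ≤ 1 / 6) (huz : 0 ≤ ⟪u, z⟫) :
    -(7 / 6 * (253 / 1000 * N)) + N * (Real.log (10 / 3) / 2) - 7 / 6 * ∑ k, ⟪g k, z⟫ ^ 2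
      ≤ tilt g (u + z) := by
  have hN0 : 0 ≤ N := hN ▸ Nat.cast_nonneg _
  rw [tilt, sum_inner_add_sq, hq, heig, ← hN, norm_add_sq_real, hu]
  set α := ⟪u, z⟫
  have hα : α ≤ 1 / 6 := (real_inner_le_norm u z).trans (by rw [hu]; linarith)
  -- Here `10/3 = 1 + 7/3` is the normalizer at `‖v‖ = 1`, and `506/1000` is twice the threshold
  -- `253/1000`, the slope needed to absorb the cross term.
  have h1 : Real.log (10 / 3) + 7 / 3 * (506 / 1000) * α
      ≤ Real.log (1 + 7 / 3 * (1 ^ 2 + 2 * α + ‖z‖ ^ 2)) := by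
    calc _ ≤ Real.log (10 / 3) + Real.log (1 + 7 / 5 * α) := by
          have h2 := Real.le_log_one_add_of_nonneg (x := 7 / 5 * α) (by positivity)
          have h3 : 7 / 3 * (506 / 1000) * α ≤ 2 * (7 / 5 * α) / (7 / 5 * α + 2) := by
            rw [le_div_iff₀ (by positivity)]
            nlinarith
          linarith
      _ = Real.log (10 / 3 * (1 + 7 / 5 * α)) := by
          rw [Real.log_mul (by norm_num) (by positivity)]
      _ ≤ _ := by
          apply Real.log_le_log (by positivity)
          nlinarith [sq_nonneg ‖z‖]
  nlinarith [mul_le_mul_of_nonneg_left h1 hN0, mul_le_mul_of_nonneg_right hqN huz]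

/-- A single bad direction makes the integral of the tilt large. Replacing it by a minimizer `u`
keeps it bad and makes it an eigenvector. The factor 2 is the price of the half ball, and the ball
of radius `1/6` about `u` lies in the one of radius `7/6` about the origin. -/
lemma volume_ball_mul_eexp_le_tilt {N T : ℝ} (hN : N = Fintype.card K) (hd : 0 < d)
    (g : K → EuclideanSpace ℝ (Fin d)) (hT : ∑ k, ‖g k‖ ^ 2 ≤ d * T)
    (hsmall : ∃ u : EuclideanSpace ℝ (Fin d), ‖u‖ = 1 ∧ ∑ k, ⟪g k, u⟫ ^ 2 < 253 / 1000 * N) :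
    volume (Metric.ball (0 : EuclideanSpace ℝ (Fin d)) (1 / 6)) *
      eexp (-(7 / 6 * (253 / 1000 * N + T / 36)) + N * (Real.log (10 / 3) / 2))
      ≤ 2 * ∫⁻ v in Metric.ball (0 : EuclideanSpace ℝ (Fin d)) (7 / 6), eexp (tilt g v) := by
  obtain ⟨u₀, hu₀, hlt⟩ := hsmall
  obtain ⟨u, hu, humin⟩ := (isCompact_sphere (0 : EuclideanSpace ℝ (Fin d)) 1).exists_isMinOn
    ⟨u₀, by simpa using hu₀⟩
    (f := fun u => ∑ k, ⟪g k, u⟫ ^ 2) (by fun_prop)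
  have hu1 : ‖u‖ = 1 := by simpa using hu
  have hmin : ∀ v : EuclideanSpace ℝ (Fin d), ‖v‖ = 1 →
      ∑ k, ⟪g k, u⟫ ^ 2 ≤ ∑ k, ⟪g k, v⟫ ^ 2 := fun v hv => humin (by simpa using hv)
  set D := Metric.ball (0 : EuclideanSpace ℝ (Fin d)) (1 / 6) ∩ {z | 0 ≤ ⟪u, z⟫}
  have hDm : MeasurableSet D :=
    Metric.isOpen_ball.measurableSet.inter (measurableSet_le (by fun_prop) (by fun_prop))
  set c := -(7 / 6 * (253 / 1000 * N)) + N * (Real.log (10 / 3) / 2)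
  calc _ = eexp c * (volume (Metric.ball (0 : EuclideanSpace ℝ (Fin d)) (1 / 6)) *
        eexp (-(7 / 6 * ((1 / 6) ^ 2 * T)))) := by
        rw [mul_left_comm, ← eexp_add]; congr 2; ring
    _ ≤ eexp c * ∫⁻ z in Metric.ball 0 (1 / 6), eexp (-(7 / 6 * ∑ k, ⟪g k, z⟫ ^ 2)) := by
        gcongr
        exact volume_ball_mul_eexp_neg_le g hd (by norm_num) hT
    _ ≤ eexp c * (2 * ∫⁻ z in D, eexp (-(7 / 6 * ∑ k, ⟪g k, z⟫ ^ 2))) := by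
        gcongr
        exact setLIntegral_ball_le_two_mul (by simp) u _
    _ = 2 * ∫⁻ z in D, eexp (c - 7 / 6 * ∑ k, ⟪g k, z⟫ ^ 2) := by
        simp_rw [sub_eq_add_neg, eexp_add]
        rw [lintegral_const_mul _ (by fun_prop)]; ring
    _ ≤ 2 * ∫⁻ z in D, eexp (tilt g (u + z)) := by
        gcongr 2 * ?_
        refine setLIntegral_mono' hDm fun z hz => eexp_mono ?_
        have hz1 : ‖z‖ < 1 / 6 := by simpa using hz.1
        exact le_tilt_add hN g hu1 rfl ((hmin u₀ hu₀).trans hlt.le)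
          (sum_inner_mul_inner_eq_of_isMinOn g hu1 hmin z) hz1.le hz.2
    _ ≤ 2 * ∫⁻ z in Metric.ball 0 (1 / 6), eexp (tilt g (u + z)) := by
        gcongr; exact Set.inter_subset_left
    _ = 2 * ∫⁻ v in Metric.ball u (1 / 6), eexp (tilt g v) := by
        rw [setLIntegral_ball_eq_add (fun v => eexp (tilt g v))]
    _ ≤ _ := by
        gcongr
        refine Metric.ball_subset_ball' ?_
        rw [dist_zero_right, hu1]; norm_num

/-- The logarithmic term of `tilt` is exactly the normalizer of the Gaussian integral of `exp (-7/6
⟪g, v⟫²)` over the samples. -/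
lemma lintegral_eexp_tilt (v : EuclideanSpace ℝ (Fin d)) :
    ∫⁻ g, eexp (tilt g v) ∂(Measure.pi fun _ : K => stdGaussian (EuclideanSpace ℝ (Fin d))) = 1 := by
  simp_rw [tilt, eexp_add, ← neg_mul, Finset.mul_sum, eexp_sum]
  rw [lintegral_mul_const _ (by fun_prop), lintegral_pi_prod
    (fun _ => stdGaussian (EuclideanSpace ℝ (Fin d))) (fun _ x => eexp (-(7 / 6) * ⟪x, v⟫ ^ 2))
    (fun _ => by fun_prop)]
  simp_rw [real_inner_comm v]
  rw [lintegral_eexp_inner_sq_stdGaussian v (by nlinarith [sq_nonneg ‖v‖]), Finset.prod_const,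
    ← eexp_nat_mul, ← eexp_add, Finset.card_univ, ← eexp_zero]
  congr 1
  ring_nf

lemma volume_ball_mul {r s : ℝ} (hr : 0 < r) :
    volume (Metric.ball (0 : EuclideanSpace ℝ (Fin d)) (r * s))
      = eexp (d * Real.log r) * volume (Metric.ball (0 : EuclideanSpace ℝ (Fin d)) s) := by
  rw [Measure.addHaar_ball_mul_of_pos _ _ hr, eexp, Real.exp_nat_mul, Real.exp_log hr]
  simp

/-- Lower tail bound for the smallest singular value of a Gaussian matrix whose Frobenius norm is
not atypically large. -/
lemma measure_exists_sum_inner_sq_lt (hd : 0 < d) {N : ℝ} (hN : N = Fintype.card K) :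
    (Measure.pi fun _ : K => stdGaussian (EuclideanSpace ℝ (Fin d)))
      {g | ∑ k, ‖g k‖ ^ 2 ≤ d * (8 / 5 * N) ∧ ∃ u : EuclideanSpace ℝ (Fin d),
        ‖u‖ = 1 ∧ ∑ k, ⟪g k, u⟫ ^ 2 < 253 / 1000 * N}
      ≤ 2 * eexp (39 / 20 * d - 2529 / 10000 * N) := by
  have : Nonempty (Fin d) := ⟨⟨0, hd⟩⟩
  have hN0 : 0 ≤ N := hN ▸ Nat.cast_nonneg _
  set P := Measure.pi fun _ : K => stdGaussian (EuclideanSpace ℝ (Fin d))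
  set I : (K → EuclideanSpace ℝ (Fin d)) → ENNReal := fun g =>
    ∫⁻ v in Metric.ball (0 : EuclideanSpace ℝ (Fin d)) (7 / 6), eexp (tilt g v)
  have hI : Measurable I :=
    Measurable.lintegral_prod_right' (measurable_eexp.comp measurable_tilt)
  set b := volume (Metric.ball (0 : EuclideanSpace ℝ (Fin d)) (1 / 6))
  have hb0 : b ≠ 0 := (Metric.measure_ball_pos _ _ (by norm_num)).ne'
  have hbt : b ≠ ⊤ := measure_ball_lt_top.ne
  have hEI : ∫⁻ g, I g ∂P = eexp (d * Real.log 7) * b := by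
    rw [lintegral_lintegral_swap (f := fun g v => eexp (tilt g v))
      (measurable_eexp.comp measurable_tilt).aemeasurable]
    simp_rw [P, lintegral_eexp_tilt]
    rw [setLIntegral_one, show (7 / 6 : ℝ) = 7 * (1 / 6) by norm_num, volume_ball_mul (by norm_num)]
  -- The volume ratio of the balls of radii `7/6` and `1/6` contributes `d log 7`. With `log 7 ≤
  -- 39/20` and `log (10/3) ≥ 6/5`, this turns `d log 7 - κ` into the stated exponent.
  set κ := -(7 / 6 * (253 / 1000 * N + 8 / 5 * N / 36)) + N * (Real.log (10 / 3) / 2)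
  have h1 : b * eexp κ * P {g | ∑ k, ‖g k‖ ^ 2 ≤ d * (8 / 5 * N) ∧
      ∃ u : EuclideanSpace ℝ (Fin d), ‖u‖ = 1 ∧ ∑ k, ⟪g k, u⟫ ^ 2 < 253 / 1000 * N}
      ≤ 2 * (eexp (d * Real.log 7) * b) := by
    rw [← hEI, ← lintegral_const_mul _ hI]
    refine le_trans ?_ (mul_meas_ge_le_lintegral₀ (hI.const_mul 2).aemeasurable (b * eexp κ))
    refine mul_le_mul_right (measure_mono fun g hg => ?_) _
    exact volume_ball_mul_eexp_le_tilt hN hd g hg.1 hg.2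
  have hl1 : 6 / 5 ≤ Real.log (10 / 3) := by
    rw [Real.le_log_iff_exp_le (by norm_num)]
    have h := Real.exp_one_lt_d9
    have h5 : Real.exp (6 / 5) ^ 5 ≤ (10 / 3) ^ 5 := by
      rw [← Real.exp_nat_mul]
      calc Real.exp ((5 : ℕ) * (6 / 5)) = Real.exp 1 ^ 6 := by
            rw [← Real.exp_nat_mul]; norm_num
        _ ≤ 2.7182818286 ^ 6 := by gcongr
        _ ≤ _ := by norm_num
    exact le_of_pow_le_pow_left₀ (by norm_num) (by norm_num) h5
  have hl2 : Real.log 7 ≤ 39 / 20 := by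
    rw [Real.log_le_iff_le_exp (by norm_num)]
    have h := Real.exp_one_gt_d9
    have h5 : (7 : ℝ) ^ 20 ≤ Real.exp (39 / 20) ^ 20 := by
      rw [← Real.exp_nat_mul]
      calc (7 : ℝ) ^ 20 ≤ 2.7182818283 ^ 39 := by norm_num
        _ ≤ Real.exp 1 ^ 39 := by gcongr
        _ = _ := by rw [← Real.exp_nat_mul]; norm_num
    exact le_of_pow_le_pow_left₀ (by norm_num) (Real.exp_pos _).le h5
  have h2 : b * eexp κ * (2 * eexp (d * Real.log 7 - κ)) = 2 * (eexp (d * Real.log 7) * b) := by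
    rw [mul_left_comm, mul_assoc b, ← eexp_add, mul_comm b]; ring_nf
  rw [← h2] at h1
  refine ((ENNReal.mul_le_mul_iff_right (mul_ne_zero hb0 (eexp_ne_zero _))
    (ENNReal.mul_ne_top hbt (eexp_ne_top _))).1 h1).trans ?_
  gcongr 2 * ?_
  apply eexp_mono
  have hd0 : (0 : ℝ) ≤ d := Nat.cast_nonneg _
  have hκ : κ = -(7 / 6 * (253 / 1000 * N + 8 / 5 * N / 36)) + N * (Real.log (10 / 3) / 2) := rfl
  rw [hκ]
  nlinarith [mul_le_mul_of_nonneg_left hl1 hN0, mul_le_mul_of_nonneg_left hl2 hd0]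

/-- Upper tail bound for the squared Frobenius norm of a Gaussian matrix. -/
lemma measure_le_sum_normSq (hd : 0 < d) {N : ℝ} (hN : N = Fintype.card K) :
    (Measure.pi fun _ : K => stdGaussian (EuclideanSpace ℝ (Fin d)))
      {g | d * (8 / 5 * N) ≤ ∑ k, ‖g k‖ ^ 2} ≤ eexp (-(N / 16)) := by
  have hN0 : 0 ≤ N := hN ▸ Nat.cast_nonneg _
  -- At parameter `3/16` the exponent per degree of freedom is at most `-3/10 + 19/80 = -1/16`.
  have h := measure_le_eexp_mul_lintegral
    (Measure.pi fun _ : K => stdGaussian (EuclideanSpace ℝ (Fin d)))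
    (f := fun g => 3 / 16 * ∑ k, ‖g k‖ ^ 2) (by fun_prop) (3 / 16 * (d * (8 / 5 * N)))
  simp_rw [Finset.mul_sum, eexp_sum] at h
  rw [lintegral_pi_prod (fun _ => stdGaussian (EuclideanSpace ℝ (Fin d)))
    (fun _ x => eexp (3 / 16 * ‖x‖ ^ 2)) (fun _ => by fun_prop)] at h
  rw [lintegral_eexp_normSq_stdGaussian (by norm_num), Finset.prod_const, ← eexp_nat_mul,
    ← eexp_add, Finset.card_univ, ← hN] at h
  have hl : -(19 / 40) ≤ Real.log (1 - 2 * (3 / 16)) := by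
    rw [Real.le_log_iff_exp_le (by norm_num), Real.exp_neg]
    have h3 : (8 / 5 : ℝ) ≤ Real.exp (19 / 40) := by
      have := Real.sum_le_exp_of_nonneg (x := 19 / 40) (by norm_num) 4
      simp [Finset.sum_range_succ, Nat.factorial] at this
      linarith
    calc (Real.exp (19 / 40))⁻¹ ≤ (8 / 5 : ℝ)⁻¹ := by gcongr
      _ ≤ _ := by norm_num
  refine le_trans (measure_mono fun g hg => ?_) (h.trans (eexp_mono ?_))
  · simp only [Set.mem_ofPred_eq, ← Finset.mul_sum] at hg ⊢
    gcongr
  · have hd1 : (1 : ℝ) ≤ d := by exact_mod_cast hd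
    have hdN : 0 ≤ N * d := by positivity
    nlinarith [mul_le_mul_of_nonneg_left hl hdN, mul_le_mul_of_nonneg_left hd1 hN0]

end

/-! ### Frobenius norm of weighted Gaussian sums. -/

section

variable {d : ℕ} {K : Type*} [Fintype K]

lemma lintegral_eexp_sum_inner (c : K → EuclideanSpace ℝ (Fin d)) :
    ∫⁻ z, eexp (∑ k, ⟪c k, z k⟫) ∂(Measure.pi fun _ : K => stdGaussian (EuclideanSpace ℝ (Fin d)))
      = eexp (∑ k, ‖c k‖ ^ 2 / 2) := by
  simp_rw [eexp_sum]
  rw [lintegral_pi_prod (fun _ => stdGaussian (EuclideanSpace ℝ (Fin d)))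
    (fun k x => eexp ⟪c k, x⟫) (fun _ => by fun_prop)]
  simp_rw [lintegral_eexp_inner_stdGaussian]

/-- Gaussian linearization: `exp (θ/2 ‖S‖²)` is the mean of `exp (√θ ⟪S, x⟫)` over an auxiliary
standard Gaussian `x`. After exchanging the integrals the samples factorize, and a chi-square moment
in `x` remains. -/
lemma lintegral_eexp_normSq_sum (c : K → ℝ) {θ : ℝ} (hθ : 0 ≤ θ) (h : θ * ∑ k, c k ^ 2 < 1) :
    ∫⁻ z, eexp (θ / 2 * ‖∑ k, c k • z k‖ ^ 2)
        ∂(Measure.pi fun _ : K => stdGaussian (EuclideanSpace ℝ (Fin d)))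
      = eexp (-(d * Real.log (1 - θ * ∑ k, c k ^ 2) / 2)) := by
  have h1 : ∀ z : K → EuclideanSpace ℝ (Fin d), eexp (θ / 2 * ‖∑ k, c k • z k‖ ^ 2)
      = ∫⁻ x, eexp (∑ k, ⟪(√θ * c k) • x, z k⟫)
        ∂(stdGaussian (EuclideanSpace ℝ (Fin d))) := by
    intro z
    have h2 : ∀ x : EuclideanSpace ℝ (Fin d), ∑ k, ⟪(√θ * c k) • x, z k⟫
        = ⟪√θ • ∑ k, c k • z k, x⟫ := by
      intro x
      rw [inner_smul_left, sum_inner, Finset.mul_sum]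
      refine Finset.sum_congr rfl fun k _ => ?_
      rw [inner_smul_left, inner_smul_left, real_inner_comm]
      simp; ring
    simp_rw [h2]
    rw [lintegral_eexp_inner_stdGaussian, norm_smul, mul_pow, Real.norm_eq_abs, sq_abs,
      Real.sq_sqrt hθ]
    congr 1; ring
  simp_rw [h1]
  rw [lintegral_lintegral_swap (by fun_prop)]
  simp_rw [lintegral_eexp_sum_inner]
  have h3 : ∀ x : EuclideanSpace ℝ (Fin d), ∑ k, ‖(√θ * c k) • x‖ ^ 2 / 2
      = (θ * (∑ k, c k ^ 2) / 2) * ‖x‖ ^ 2 := by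
    intro x
    rw [Finset.mul_sum, Finset.sum_div, Finset.sum_mul]
    refine Finset.sum_congr rfl fun k _ => ?_
    rw [norm_smul, mul_pow, Real.norm_eq_abs, sq_abs, mul_pow, Real.sq_sqrt hθ]
    ring
  simp_rw [h3]
  rw [lintegral_eexp_normSq_stdGaussian (by linarith)]
  congr 5; ring

lemma eexp_sum_mul_le {ι : Type*} [Fintype ι] {p : ι → ℝ} (hp : ∀ i, 0 ≤ p i)
    (hp1 : ∑ i, p i = 1) (y : ι → ℝ) :
    eexp (∑ i, p i * y i) ≤ ∑ i, ENNReal.ofReal (p i) * eexp (y i) := by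
  have h := convexOn_exp.map_sum_le (t := Finset.univ) (w := p) (p := y) (fun i _ => hp i) hp1
    (fun i _ => Set.mem_univ _)
  simp only [smul_eq_mul] at h
  unfold eexp
  simp_rw [← ENNReal.ofReal_mul (hp _)]
  rw [← ENNReal.ofReal_sum_of_nonneg fun i _ => mul_nonneg (hp i) (Real.exp_pos _).le]
  exact ENNReal.ofReal_le_ofReal h

/-- Upper tail bound for the squared Frobenius norm of a weighted sum of Gaussian vectors. -/
lemma measure_lt_sum_normSq_sum {ι : Type*} [Fintype ι] (m : K → ι → ℝ) {V R q : ℝ} (hR : 0 ≤ R)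
    (hV : ∑ i, ∑ k, m k i ^ 2 ≤ V) (hq0 : 0 ≤ q) (hq1 : q < 1) :
    (Measure.pi fun _ : K => stdGaussian (EuclideanSpace ℝ (Fin d)))
      {z | V * R < ∑ i, ‖∑ k, m k i • z k‖ ^ 2}
      ≤ eexp (-(q * R / 2) - d * Real.log (1 - q) / 2) := by
  set P := Measure.pi fun _ : K => stdGaussian (EuclideanSpace ℝ (Fin d))
  set s : ι → ℝ := fun i => ∑ k, m k i ^ 2
  have hs : ∀ i, 0 ≤ s i := fun i => Finset.sum_nonneg fun k _ => sq_nonneg _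
  have hS : 0 ≤ ∑ i, s i := Finset.sum_nonneg fun i _ => hs i
  have hzero : ∀ i, s i = 0 → ∀ z : K → EuclideanSpace ℝ (Fin d), ∑ k, m k i • z k = 0 := by
    intro i hi z
    rw [Finset.sum_eq_zero_iff_of_nonneg fun k _ => sq_nonneg _] at hi
    exact Finset.sum_eq_zero fun k hk => by rw [pow_eq_zero_iff two_ne_zero |>.1 (hi k hk), zero_smul]
  rcases hS.eq_or_lt with hS0 | hS0
  · have : {z : K → EuclideanSpace ℝ (Fin d) | V * R < ∑ i, ‖∑ k, m k i • z k‖ ^ 2} = ∅ := by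
      ext z
      have h0 : ∀ i, s i = 0 := fun i =>
        (Finset.sum_eq_zero_iff_of_nonneg fun i _ => hs i).1 hS0.symm i (Finset.mem_univ i)
      simp only [hzero _ (h0 _) z, Set.mem_ofPred_eq, Set.mem_empty_iff_false, iff_false, not_lt]
      simpa using mul_nonneg (hS.trans hV) hR
    rw [this]; simp
  set S := ∑ i, s i
  -- Each row is normalized by its own variance, so that all rows obey the same moment bound. The
  -- total is their convex combination with weights `s i / S`, and Jensen makes the bound
  -- independent of the number of rows.
  set y : ι → (K → EuclideanSpace ℝ (Fin d)) → ℝ := fun i z => q / s i / 2 * ‖∑ k, m k i • z k‖ ^ 2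
  have hy : ∀ i z, s i / S * y i z = q / (2 * S) * ‖∑ k, m k i • z k‖ ^ 2 := by
    intro i z
    rcases eq_or_ne (s i) 0 with h | h
    · simp [h, hzero i h z]
    · simp only [y]; field_simp
  have hEy : ∀ i, ∫⁻ z, eexp (y i z) ∂P ≤ eexp (-(d * Real.log (1 - q) / 2)) := by
    intro i
    -- A row of zero variance has `q / s i = 0` by convention, so `y i` vanishes.
    rcases eq_or_ne (s i) 0 with h | h
    · simp only [y, h, div_zero, zero_div, zero_mul, eexp_zero, lintegral_one, measure_univ]
      rw [← eexp_zero]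
      apply eexp_mono
      have := Real.log_nonpos (x := 1 - q) (by linarith) (by linarith)
      have : (d : ℝ) * Real.log (1 - q) ≤ 0 := mul_nonpos_of_nonneg_of_nonpos (by positivity) this
      linarith
    · have h1 : q / s i * ∑ k, m k i ^ 2 = q := div_mul_cancel₀ q h
      simp only [y]
      rw [lintegral_eexp_normSq_sum (fun k => m k i) (div_nonneg hq0 (hs i)) (by rw [h1]; exact hq1),
        h1]
  have hE : ∫⁻ z, eexp (q / (2 * S) * ∑ i, ‖∑ k, m k i • z k‖ ^ 2) ∂P
      ≤ eexp (-(d * Real.log (1 - q) / 2)) := by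
    have hp1 : ∑ i, s i / S = 1 := by rw [← Finset.sum_div]; exact div_self hS0.ne'
    calc _ ≤ ∫⁻ z, ∑ i, ENNReal.ofReal (s i / S) * eexp (y i z) ∂P := by
          refine lintegral_mono fun z => ?_
          rw [Finset.mul_sum]
          simp_rw [← hy]
          exact eexp_sum_mul_le (fun i => div_nonneg (hs i) hS) hp1 fun i => y i z
      _ = ∑ i, ENNReal.ofReal (s i / S) * ∫⁻ z, eexp (y i z) ∂P := by
          rw [lintegral_finsetSum _ fun i _ => by fun_prop]
          exact Finset.sum_congr rfl fun i _ => lintegral_const_mul _ (by fun_prop)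
      _ ≤ ∑ i, ENNReal.ofReal (s i / S) * eexp (-(d * Real.log (1 - q) / 2)) := by
          gcongr; exact hEy _
      _ = _ := by
          rw [← Finset.sum_mul, ← ENNReal.ofReal_sum_of_nonneg fun i _ => div_nonneg (hs i) hS, hp1]
          simp
  have hM := measure_le_eexp_mul_lintegral P
    (f := fun z => q / (2 * S) * ∑ i, ‖∑ k, m k i • z k‖ ^ 2) (by fun_prop) (q * R / 2)
  rw [sub_eq_add_neg, eexp_add]
  refine (measure_mono fun z hz => ?_).trans (hM.trans (by gcongr))
  simp only [Set.mem_ofPred_eq] at hz ⊢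
  calc q * R / 2 = q / (2 * S) * (S * R) := by field_simp
    _ ≤ q / (2 * S) * ∑ i, ‖∑ k, m k i • z k‖ ^ 2 := by
      gcongr
      exact (mul_le_mul_of_nonneg_right hV hR).trans hz.le

/-! ### Spectral norm of a product of independent Gaussian matrices. -/

variable {n l : ℕ}

/-- Integrating `h` out for fixed `g` leaves the exponential of a multiple of `⟪u, g⟫²`, a
chi-square moment. -/
lemma lintegral_eexp_inner_mul_inner (u : EuclideanSpace ℝ (Fin n)) (w : EuclideanSpace ℝ (Fin l))
    {θ : ℝ} (hθ : θ ^ 2 < 1) (hu : ‖u‖ ≤ 1) (hw : ‖w‖ ≤ 1) :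
    ∫⁻ p, eexp (θ * (⟪w, p.2⟫ * ⟪u, p.1⟫)) ∂((stdGaussian (EuclideanSpace ℝ (Fin n))).prod
      (stdGaussian (EuclideanSpace ℝ (Fin l)))) ≤ eexp (-(Real.log (1 - θ ^ 2) / 2)) := by
  rw [lintegral_prod _ (by fun_prop)]
  have h1 : ∀ g : EuclideanSpace ℝ (Fin n), ∫⁻ h, eexp (θ * (⟪w, h⟫ * ⟪u, g⟫))
      ∂(stdGaussian (EuclideanSpace ℝ (Fin l))) = eexp ((θ * ‖w‖) ^ 2 / 2 * ⟪u, g⟫ ^ 2) := by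
    intro g
    have h2 : ∀ h : EuclideanSpace ℝ (Fin l), θ * (⟪w, h⟫ * ⟪u, g⟫) = ⟪(θ * ⟪u, g⟫) • w, h⟫ := by
      intro h
      rw [inner_smul_left]; simp; ring
    simp_rw [h2]
    rw [lintegral_eexp_inner_stdGaussian, norm_smul, mul_pow, Real.norm_eq_abs, sq_abs]
    congr 1; ring
  simp_rw [h1]
  have hw2 : ‖w‖ ^ 2 ≤ 1 := pow_le_one₀ (norm_nonneg _) hw
  have hu2 : ‖u‖ ^ 2 ≤ 1 := pow_le_one₀ (norm_nonneg _) hu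
  have hle : 2 * ((θ * ‖w‖) ^ 2 / 2) * ‖u‖ ^ 2 ≤ θ ^ 2 := by
    calc _ = θ ^ 2 * (‖w‖ ^ 2 * ‖u‖ ^ 2) := by ring
      _ ≤ θ ^ 2 * (1 * 1) := by gcongr
      _ = _ := by ring
  rw [lintegral_eexp_inner_sq_stdGaussian u (by linarith)]
  apply eexp_mono
  have := Real.log_le_log (x := 1 - θ ^ 2) (y := 1 - 2 * ((θ * ‖w‖) ^ 2 / 2) * ‖u‖ ^ 2)
    (by linarith) (by linarith)
  linarith

/-- The bilinear form of the matrix `∑ₖ hₖ gₖ*` of Gaussian samples `(gₖ, hₖ)`. -/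
noncomputable def crossForm (p : K → EuclideanSpace ℝ (Fin n) × EuclideanSpace ℝ (Fin l))
    (u : EuclideanSpace ℝ (Fin n)) (w : EuclideanSpace ℝ (Fin l)) : ℝ :=
  ∑ k, ⟪w, (p k).2⟫ * ⟪u, (p k).1⟫

/-- The common law of the Gaussian pairs `(gₖ, hₖ)`. -/
noncomputable abbrev pairLaw (K : Type*) [Fintype K] (n l : ℕ) :
    Measure (K → EuclideanSpace ℝ (Fin n) × EuclideanSpace ℝ (Fin l)) :=
  Measure.pi fun _ => (stdGaussian (EuclideanSpace ℝ (Fin n))).prod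
    (stdGaussian (EuclideanSpace ℝ (Fin l)))

lemma lintegral_eexp_crossForm (u : EuclideanSpace ℝ (Fin n)) (w : EuclideanSpace ℝ (Fin l))
    {θ : ℝ} (hθ : θ ^ 2 < 1) (hu : ‖u‖ ≤ 1) (hw : ‖w‖ ≤ 1) :
    ∫⁻ p, eexp (θ * crossForm p u w) ∂(pairLaw K n l)
      ≤ eexp (-(Fintype.card K * Real.log (1 - θ ^ 2) / 2)) := by
  simp_rw [crossForm, Finset.mul_sum, eexp_sum]
  rw [lintegral_pi_prod (fun _ => (stdGaussian (EuclideanSpace ℝ (Fin n))).prod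
    (stdGaussian (EuclideanSpace ℝ (Fin l)))) (fun _ p => eexp (θ * (⟪w, p.2⟫ * ⟪u, p.1⟫)))
    (fun _ => by fun_prop), Finset.prod_const, Finset.card_univ]
  calc _ ≤ eexp (-(Real.log (1 - θ ^ 2) / 2)) ^ Fintype.card K := by
        gcongr; exact lintegral_eexp_inner_mul_inner u w hθ hu hw
    _ = _ := by rw [← eexp_nat_mul]; congr 1; ring

lemma crossForm_eq_inner_right (p : K → EuclideanSpace ℝ (Fin n) × EuclideanSpace ℝ (Fin l))
    (u : EuclideanSpace ℝ (Fin n)) (w : EuclideanSpace ℝ (Fin l)) :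
    crossForm p u w = ⟪∑ k, ⟪u, (p k).1⟫ • (p k).2, w⟫ := by
  rw [crossForm, sum_inner]
  refine Finset.sum_congr rfl fun k _ => ?_
  rw [inner_smul_left, real_inner_comm w]; simp; ring

lemma crossForm_eq_inner_left (p : K → EuclideanSpace ℝ (Fin n) × EuclideanSpace ℝ (Fin l))
    (u : EuclideanSpace ℝ (Fin n)) (w : EuclideanSpace ℝ (Fin l)) :
    crossForm p u w = ⟪∑ k, ⟪w, (p k).2⟫ • (p k).1, u⟫ := by
  rw [crossForm, sum_inner]
  refine Finset.sum_congr rfl fun k _ => ?_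
  rw [inner_smul_left, real_inner_comm u]; simp

lemma ball_smul_subset {u : EuclideanSpace ℝ (Fin d)} (hu : ‖u‖ = 1) :
    Metric.ball ((3 / 4 : ℝ) • u) (1 / 4) ⊆ Metric.ball 0 1 := by
  refine Metric.ball_subset_ball' ?_
  rw [dist_zero_right, norm_smul, hu]; norm_num

lemma measurable_eexp_crossForm (θ : ℝ) : Measurable (fun q : (K → EuclideanSpace ℝ (Fin n) ×
    EuclideanSpace ℝ (Fin l)) × (EuclideanSpace ℝ (Fin n) × EuclideanSpace ℝ (Fin l)) =>
    eexp (θ * crossForm q.1 q.2.1 q.2.2)) := by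
  unfold crossForm; fun_prop

/-- The balls of radius `1/4` about `3/4 u` and `3/4 w` lie in the unit balls. The form is linear in
each variable, so the averaging inequality applies twice; the centres give the factor `9/16`. -/
lemma volume_mul_eexp_crossForm_le (θ : ℝ)
    (p : K → EuclideanSpace ℝ (Fin n) × EuclideanSpace ℝ (Fin l))
    {u : EuclideanSpace ℝ (Fin n)} {w : EuclideanSpace ℝ (Fin l)} (hu : ‖u‖ = 1) (hw : ‖w‖ = 1) :
    volume (Metric.ball (0 : EuclideanSpace ℝ (Fin n)) (1 / 4)) *
      volume (Metric.ball (0 : EuclideanSpace ℝ (Fin l)) (1 / 4)) *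
      eexp (θ * (9 / 16 * crossForm p u w))
      ≤ ∫⁻ q, eexp (θ * crossForm p q.1 q.2)
        ∂((volume.restrict (Metric.ball (0 : EuclideanSpace ℝ (Fin n)) 1)).prod
          (volume.restrict (Metric.ball (0 : EuclideanSpace ℝ (Fin l)) 1))) := by
  rw [lintegral_prod (fun q => eexp (θ * crossForm p q.1 q.2))
    (((measurable_eexp_crossForm θ).comp measurable_prodMk_left).aemeasurable)]
  have h1 : ∀ v : EuclideanSpace ℝ (Fin n),
      volume (Metric.ball (0 : EuclideanSpace ℝ (Fin l)) (1 / 4)) *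
        eexp (θ * crossForm p v ((3 / 4 : ℝ) • w))
      ≤ ∫⁻ w in Metric.ball (0 : EuclideanSpace ℝ (Fin l)) 1, eexp (θ * crossForm p v w) := by
    intro v
    refine le_trans ?_ (lintegral_mono_set (ball_smul_subset hw))
    simp_rw [crossForm_eq_inner_right, ← real_inner_smul_left]
    exact volume_ball_mul_eexp_le _ _ _
  refine le_trans ?_ (lintegral_mono h1)
  rw [lintegral_const_mul _ (by unfold crossForm; fun_prop), mul_comm (volume _), mul_assoc]
  gcongr
  refine le_trans ?_ (lintegral_mono_set (ball_smul_subset hu))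
  have h2 : θ * (9 / 16 * crossForm p u w)
      = θ * crossForm p ((3 / 4 : ℝ) • u) ((3 / 4 : ℝ) • w) := by
    simp only [crossForm, Finset.mul_sum]
    refine Finset.sum_congr rfl fun k _ => ?_
    rw [real_inner_smul_left, real_inner_smul_left]; ring
  rw [h2]
  simp_rw [crossForm_eq_inner_left, ← real_inner_smul_left]
  exact volume_ball_mul_eexp_le _ _ _

/-- Upper tail bound for the spectral norm of the product of two independent Gaussian matrices. -/
lemma measure_exists_lt_crossForm {θ r : ℝ} (hθ0 : 0 ≤ θ) (hθ : θ ^ 2 < 1) :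
    pairLaw K n l {p | ∃ (u : EuclideanSpace ℝ (Fin n)) (w : EuclideanSpace ℝ (Fin l)),
      ‖u‖ = 1 ∧ ‖w‖ = 1 ∧ r < crossForm p u w}
      ≤ eexp ((n + l) * Real.log 4 - Fintype.card K * Real.log (1 - θ ^ 2) / 2
        - θ * (9 / 16 * r)) := by
  set P := pairLaw K n l
  set ν := (volume.restrict (Metric.ball (0 : EuclideanSpace ℝ (Fin n)) 1)).prod
          (volume.restrict (Metric.ball (0 : EuclideanSpace ℝ (Fin l)) 1))
  set b := volume (Metric.ball (0 : EuclideanSpace ℝ (Fin n)) (1 / 4)) *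
      volume (Metric.ball (0 : EuclideanSpace ℝ (Fin l)) (1 / 4))
  have hb0 : b ≠ 0 := mul_ne_zero (Metric.measure_ball_pos _ _ (by norm_num)).ne'
    (Metric.measure_ball_pos _ _ (by norm_num)).ne'
  have hbt : b ≠ ⊤ := ENNReal.mul_ne_top measure_ball_lt_top.ne measure_ball_lt_top.ne
  set I : (K → EuclideanSpace ℝ (Fin n) × EuclideanSpace ℝ (Fin l)) → ENNReal :=
    fun p => ∫⁻ q, eexp (θ * crossForm p q.1 q.2) ∂ν
  have hI : Measurable I := Measurable.lintegral_prod_right' (measurable_eexp_crossForm θ)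
  set Λ := -(Fintype.card K * Real.log (1 - θ ^ 2) / 2)
  have hν : ν Set.univ = eexp ((n + l) * Real.log 4) * b := by
    rw [← Set.univ_prod_univ, Measure.prod_prod, Measure.restrict_apply_univ,
      Measure.restrict_apply_univ, show (1 : ℝ) = 4 * (1 / 4) by norm_num,
      volume_ball_mul (by norm_num), volume_ball_mul (by norm_num), add_mul, eexp_add]
    simp only [b]
    ring
  have hEI : ∫⁻ p, I p ∂P ≤ eexp Λ * (eexp ((n + l) * Real.log 4) * b) := by
    have hswap := lintegral_lintegral_swap (μ := P) (ν := ν)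
      (f := fun p q => eexp (θ * crossForm p q.1 q.2)) (measurable_eexp_crossForm θ).aemeasurable
    refine hswap.le.trans ?_
    rw [← hν, ← lintegral_const]
    -- The moment bound is available only for vectors of norm at most one, that is, almost
    -- everywhere for `ν`.
    refine lintegral_mono_ae ?_
    have h1 : ∀ᵐ q ∂ν, q ∈ Metric.ball (0 : EuclideanSpace ℝ (Fin n)) 1 ×ˢ
        Metric.ball (0 : EuclideanSpace ℝ (Fin l)) 1 := by
      have h2 : ν = ((volume : Measure (EuclideanSpace ℝ (Fin n))).prod
          (volume : Measure (EuclideanSpace ℝ (Fin l)))).restrict (Metric.ball 0 1 ×ˢ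
            Metric.ball 0 1) := Measure.prod_restrict _ _
      rw [h2]
      exact ae_restrict_mem (Metric.isOpen_ball.measurableSet.prod Metric.isOpen_ball.measurableSet)
    filter_upwards [h1] with q hq
    have hq1 : ‖q.1‖ < 1 := by simpa using hq.1
    have hq2 : ‖q.2‖ < 1 := by simpa using hq.2
    exact lintegral_eexp_crossForm q.1 q.2 hθ hq1.le hq2.le
  have h1 := (mul_meas_ge_le_lintegral₀ hI.aemeasurable (b * eexp (θ * (9 / 16 * r)))).trans hEI
  have h2 : eexp Λ * (eexp ((n + l) * Real.log 4) * b) = b * eexp (θ * (9 / 16 * r)) *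
      eexp ((n + l) * Real.log 4 + Λ - θ * (9 / 16 * r)) := by
    rw [mul_assoc b, ← eexp_add, ← mul_assoc, ← eexp_add, mul_comm b]
    congr 2; ring
  rw [h2] at h1
  refine (measure_mono fun p hp => ?_).trans
    ((ENNReal.mul_le_mul_iff_right (mul_ne_zero hb0 (eexp_ne_zero _))
      (ENNReal.mul_ne_top hbt (eexp_ne_top _))).1 h1)
  obtain ⟨u, w, hu, hw, hr⟩ := hp
  refine le_trans ?_ (volume_mul_eexp_crossForm_le θ p hu hw)
  gcongr
  exact eexp_mono (by gcongr)

end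

/-! ### Deterministic matrix bounds and the least-squares error. -/

section

variable {n l : ℕ} {K : Type*} [Fintype K]

lemma inner_toEuclideanLin_sum_vecMulVec (a : K → EuclideanSpace ℝ (Fin l))
    (b : K → EuclideanSpace ℝ (Fin n)) (w : EuclideanSpace ℝ (Fin l))
    (u : EuclideanSpace ℝ (Fin n)) :
    ⟪w, Matrix.toEuclideanLin (∑ k, Matrix.vecMulVec (a k).ofLp (b k).ofLp) u⟫
      = ∑ k, ⟪w, a k⟫ * ⟪b k, u⟫ := by
  rw [map_sum, LinearMap.sum_apply, inner_sum]
  refine Finset.sum_congr rfl fun k _ => ?_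
  have : Matrix.toEuclideanLin (Matrix.vecMulVec (a k).ofLp (b k).ofLp) u = ⟪b k, u⟫ • a k := by
    ext i
    simp [Matrix.toLpLin_apply, Matrix.vecMulVec_mulVec, EuclideanSpace.inner_eq_star_dotProduct,
      dotProduct_comm]
  rw [this, inner_smul_right, mul_comm]

lemma opNorm_le_of_inner_le (A : Matrix (Fin l) (Fin n) ℝ) {r : ℝ} (hr : 0 ≤ r)
    (h : ∀ (u : EuclideanSpace ℝ (Fin n)) (w : EuclideanSpace ℝ (Fin l)), ‖u‖ = 1 → ‖w‖ = 1 →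
      ⟪w, Matrix.toEuclideanLin A u⟫ ≤ r) : ‖A‖ ≤ r := by
  rw [Matrix.l2_opNorm_def]
  refine ContinuousLinearMap.opNorm_le_bound _ hr fun u => ?_
  change ‖Matrix.toEuclideanLin A u‖ ≤ r * ‖u‖
  set v := Matrix.toEuclideanLin A u
  rcases eq_or_ne v 0 with hv | hv
  · rw [hv, norm_zero]; positivity
  have hu : u ≠ 0 := by rintro rfl; exact hv (map_zero _)
  have hu' : 0 < ‖u‖ := norm_pos_iff.2 hu
  have hv' : 0 < ‖v‖ := norm_pos_iff.2 hv
  have h1 := h (‖u‖⁻¹ • u) (‖v‖⁻¹ • v) (by rw [norm_smul]; simp [hu'.ne'])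
    (by rw [norm_smul]; simp [hv'.ne'])
  rw [map_smul, real_inner_smul_left, real_inner_smul_right] at h1
  change ‖v‖⁻¹ * (‖u‖⁻¹ * ⟪v, v⟫) ≤ r at h1
  rw [real_inner_self_eq_norm_sq] at h1
  have h2 : ‖v‖⁻¹ * (‖u‖⁻¹ * ‖v‖ ^ 2) = ‖v‖ / ‖u‖ := by field_simp
  rwa [h2, div_le_iff₀ hu'] at h1

lemma le_norm_toEuclideanLin {S : Matrix (Fin n) (Fin n) ℝ} {c : ℝ}
    (h : ∀ u : EuclideanSpace ℝ (Fin n), ‖u‖ = 1 → c ≤ ⟪u, Matrix.toEuclideanLin S u⟫)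
    (u : EuclideanSpace ℝ (Fin n)) : c * ‖u‖ ≤ ‖Matrix.toEuclideanLin S u‖ := by
  rcases eq_or_ne u 0 with rfl | hu
  · simp
  have hu' : 0 < ‖u‖ := norm_pos_iff.2 hu
  have hn : ‖‖u‖⁻¹ • u‖ = 1 := by rw [norm_smul]; simp [hu'.ne']
  have h1 := (h _ hn).trans (real_inner_le_norm _ _)
  rw [hn, one_mul, map_smul, norm_smul, norm_inv, norm_norm, inv_mul_eq_div, le_div_iff₀ hu'] at h1
  exact h1

/-- By Cauchy–Schwarz coercivity gives `c ‖u‖ ≤ ‖S u‖`, hence injectivity, and the norm bound on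
applying it to `S⁻¹ v`. -/
lemma isUnit_and_norm_inv_le {S : Matrix (Fin n) (Fin n) ℝ} {c : ℝ} (hc : 0 < c)
    (h : ∀ u : EuclideanSpace ℝ (Fin n), ‖u‖ = 1 → c ≤ ⟪u, Matrix.toEuclideanLin S u⟫) :
    IsUnit S ∧ ‖S⁻¹‖ ≤ 1 / c := by
  have h1 := le_norm_toEuclideanLin h
  have hS : IsUnit S := by
    rw [← Matrix.mulVec_injective_iff_isUnit]
    refine (injective_iff_map_eq_zero S.mulVecLin).2 fun v hv => ?_
    have h2 := h1 (WithLp.toLp 2 v)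
    have h3 : Matrix.toEuclideanLin S (WithLp.toLp 2 v) = 0 := by
      ext i
      have := congrFun hv i
      simpa [Matrix.toLpLin_apply] using this
    rw [h3, norm_zero] at h2
    have h4 : ‖WithLp.toLp 2 v‖ = 0 := le_antisymm (by nlinarith) (norm_nonneg _)
    exact (WithLp.toLp_eq_zero 2).1 (norm_eq_zero.1 h4)
  refine ⟨hS, ?_⟩
  rw [Matrix.l2_opNorm_def]
  refine ContinuousLinearMap.opNorm_le_bound _ (by positivity) fun v => ?_
  change ‖Matrix.toEuclideanLin S⁻¹ v‖ ≤ 1 / c * ‖v‖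
  have h2 := h1 (Matrix.toEuclideanLin S⁻¹ v)
  have h3 : Matrix.toEuclideanLin S (Matrix.toEuclideanLin S⁻¹ v) = v := by
    have hdet := (Matrix.isUnit_iff_isUnit_det S).1 hS
    ext i
    simp [Matrix.toLpLin_apply, Matrix.mulVec_mulVec, Matrix.mul_nonsing_inv S hdet]
  rw [h3] at h2
  rw [one_div, inv_mul_eq_div, le_div_iff₀ hc, mul_comm]
  exact h2

section
open scoped MatrixOrder

/-- Both sides say that `A - c` is positive semidefinite. Positive dimension is needed because the
infimum of an empty spectrum would be the default value 0. -/
lemma le_lambdaMin_iff {A : Matrix (Fin n) (Fin n) ℝ} (hn : 0 < n) (hA : A.IsHermitian) (c : ℝ) :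
    c ≤ lambdaMin A ↔
      ∀ u : EuclideanSpace ℝ (Fin n), ‖u‖ = 1 → c ≤ ⟪u, Matrix.toEuclideanLin A u⟫ := by
  have hne : (spectrum ℝ A).Nonempty := ⟨_, hA.eigenvalues_mem_spectrum_real ⟨0, hn⟩⟩
  have hbdd : BddBelow (spectrum ℝ A) := (Matrix.finite_real_spectrum (A := A)).bddBelow
  rw [lambdaMin, le_csInf_iff hbdd hne]
  change (∀ b ∈ spectrum ℝ A, c ≤ b) ↔ _
  rw [← algebraMap_le_iff_le_spectrum (a := A) (r := c) hA, Matrix.le_iff]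
  have hq : ∀ u : EuclideanSpace ℝ (Fin n),
      star u.ofLp ⬝ᵥ ((A - algebraMap ℝ _ c).mulVec u.ofLp)
        = ⟪u, Matrix.toEuclideanLin A u⟫ - c * ‖u‖ ^ 2 := by
    intro u
    rw [← real_inner_self_eq_norm_sq, Algebra.algebraMap_eq_smul_one, Matrix.sub_mulVec,
      dotProduct_sub, Matrix.smul_mulVec, Matrix.one_mulVec, dotProduct_smul,
      EuclideanSpace.inner_eq_star_dotProduct, EuclideanSpace.inner_eq_star_dotProduct]
    simp [Matrix.toLpLin_apply, dotProduct_comm]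
  constructor
  · intro h u hu
    have := h.dotProduct_mulVec_nonneg u.ofLp
    rw [hq, hu] at this
    linarith
  · intro h
    refine Matrix.PosSemidef.of_dotProduct_mulVec_nonneg ?_ fun v => ?_
    · exact hA.sub (by rw [Algebra.algebraMap_eq_smul_one]; simp [Matrix.IsHermitian])
    · rw [show v = (WithLp.toLp 2 v : EuclideanSpace ℝ (Fin n)).ofLp from rfl, hq]
      set u := (WithLp.toLp 2 v : EuclideanSpace ℝ (Fin n))
      rcases eq_or_ne u 0 with hu | hu
      · simp [hu]
      have hu' : 0 < ‖u‖ := norm_pos_iff.2 hu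
      have h1 := h (‖u‖⁻¹ • u) (by rw [norm_smul]; simp [hu'.ne'])
      rw [map_smul, real_inner_smul_left, real_inner_smul_right] at h1
      have h2 : c * ‖u‖ ^ 2 ≤ ‖u‖⁻¹ * (‖u‖⁻¹ * ⟪u, Matrix.toEuclideanLin A u⟫) * ‖u‖ ^ 2 := by
        gcongr
      have h3 : ‖u‖⁻¹ * (‖u‖⁻¹ * ⟪u, Matrix.toEuclideanLin A u⟫) * ‖u‖ ^ 2
          = ⟪u, Matrix.toEuclideanLin A u⟫ := by field_simp
      linarith
end

lemma isHermitian_sum_vecMulVec (a : K → EuclideanSpace ℝ (Fin n)) :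
    (∑ k, Matrix.vecMulVec (a k).ofLp (a k).ofLp).IsHermitian := by
  rw [Matrix.IsHermitian, Matrix.conjTranspose_sum]
  refine Finset.sum_congr rfl fun k _ => ?_
  ext i j
  simp [Matrix.vecMulVec_apply, mul_comm]

lemma inner_toEuclideanLin_one_add_smul (A : Matrix (Fin n) (Fin n) ℝ) (c : ℝ)
    {u : EuclideanSpace ℝ (Fin n)} (hu : ‖u‖ = 1) :
    ⟪u, Matrix.toEuclideanLin (1 + c • A) u⟫ = 1 + c * ⟪u, Matrix.toEuclideanLin A u⟫ := by
  rw [map_add, LinearMap.add_apply, map_smul, LinearMap.smul_apply, inner_add_right,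
    inner_smul_right]
  have : Matrix.toEuclideanLin (1 : Matrix (Fin n) (Fin n) ℝ) u = u := by
    ext i; simp
  rw [this, real_inner_self_eq_norm_sq, hu]; norm_num

/-- The bilinear form of `∑ₖ zₖ aₖ*` is controlled by its Frobenius norm. -/
lemma abs_sum_inner_mul_inner_le (a : K → EuclideanSpace ℝ (Fin n))
    (z : K → EuclideanSpace ℝ (Fin l)) {F : ℝ} (hF : 0 ≤ F)
    (h : ∑ i, ‖∑ k, (a k) i • z k‖ ^ 2 ≤ F ^ 2) {u : EuclideanSpace ℝ (Fin n)}
    {w : EuclideanSpace ℝ (Fin l)} (hu : ‖u‖ = 1) (hw : ‖w‖ = 1) :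
    |∑ k, ⟪w, z k⟫ * ⟪a k, u⟫| ≤ F := by
  have h1 : ∑ k, ⟪w, z k⟫ * ⟪a k, u⟫ = ∑ i, u i * ⟪w, ∑ k, (a k) i • z k⟫ := by
    simp_rw [inner_sum, inner_smul_right, Finset.mul_sum]
    rw [Finset.sum_comm]
    refine Finset.sum_congr rfl fun k _ => ?_
    rw [PiLp.inner_apply (a k) u, Finset.mul_sum]
    refine Finset.sum_congr rfl fun i _ => ?_
    simp; ring
  rw [h1]
  apply abs_le_of_sq_le_sq _ hF
  calc _ ≤ (∑ i, u i ^ 2) * ∑ i, ⟪w, ∑ k, (a k) i • z k⟫ ^ 2 := Finset.sum_mul_sq_le_sq_mul_sq _ _ _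
    _ = ∑ i, ⟪w, ∑ k, (a k) i • z k⟫ ^ 2 := by
        rw [← EuclideanSpace.real_norm_sq_eq, hu]; simp
    _ ≤ ∑ i, ‖∑ k, (a k) i • z k‖ ^ 2 := by
        refine Finset.sum_le_sum fun i _ => ?_
        rw [← sq_abs ⟪w, _⟫]
        refine pow_le_pow_left₀ (abs_nonneg _) ?_ 2
        simpa [hw] using abs_real_inner_le_norm w (∑ k, (a k) i • z k)
    _ ≤ _ := h

/-- Lower bound for the Gram form of the features `μₖ + σ gₖ`. -/
lemma le_sum_inner_sq {N σ : ℝ} (hN : 0 ≤ N) (hσ : 0 ≤ σ) (μ g : K → EuclideanSpace ℝ (Fin n))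
    {u : EuclideanSpace ℝ (Fin n)} (hu : ‖u‖ = 1)
    (hG : 253 / 1000 * N ≤ ∑ k, ⟪g k, u⟫ ^ 2)
    (hF : ∑ i, ‖∑ k, (μ k) i • g k‖ ^ 2 ≤ (319 / 5000 * (N * σ)) ^ 2) :
    N * σ ^ 2 / 8 + (∑ k, ⟪μ k, u⟫ ^ 2) / 2 ≤ ∑ k, ⟪u, μ k + σ • g k⟫ ^ 2 := by
  have hX := (abs_le.1 (abs_sum_inner_mul_inner_le μ g (by positivity) hF hu hu)).1
  have hM : 0 ≤ ∑ k, ⟪μ k, u⟫ ^ 2 := Finset.sum_nonneg fun k _ => sq_nonneg _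
  have h1 : ∑ k, ⟪u, μ k + σ • g k⟫ ^ 2 = ∑ k, ⟪μ k, u⟫ ^ 2
      + 2 * σ * ∑ k, ⟪u, g k⟫ * ⟪μ k, u⟫ + σ ^ 2 * ∑ k, ⟪g k, u⟫ ^ 2 := by
    simp_rw [Finset.mul_sum, ← Finset.sum_add_distrib]
    refine Finset.sum_congr rfl fun k _ => ?_
    rw [inner_add_right, inner_smul_right, real_inner_comm u (μ k), real_inner_comm u (g k)]
    ring
  rw [h1]
  -- The margin is `253/1000 - 2 · 319/5000 = 0.1254 ≥ 1/8`.
  nlinarith [mul_le_mul_of_nonneg_left hX hσ, mul_le_mul_of_nonneg_left hG (sq_nonneg σ),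
    mul_nonneg hN (sq_nonneg σ)]

/-- Upper bound for the cross form of the noises `σ' hₖ` and the features `μₖ + σ gₖ`. -/
lemma sum_inner_mul_inner_le {σ σ' r s : ℝ} (hσ : 0 ≤ σ) (hσ' : 0 ≤ σ') (hs : 0 ≤ s)
    (μ : K → EuclideanSpace ℝ (Fin n))
    (p : K → EuclideanSpace ℝ (Fin n) × EuclideanSpace ℝ (Fin l))
    {u : EuclideanSpace ℝ (Fin n)} {w : EuclideanSpace ℝ (Fin l)} (hu : ‖u‖ = 1) (hw : ‖w‖ = 1)
    (hr : crossForm p u w ≤ r) (hF : ∑ i, ‖∑ k, (μ k) i • (p k).2‖ ^ 2 ≤ s ^ 2) :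
    ∑ k, ⟪w, σ' • (p k).2⟫ * ⟪μ k + σ • (p k).1, u⟫ ≤ σ' * (σ * r + s) := by
  have hX := (abs_le.1 (abs_sum_inner_mul_inner_le μ (fun k => (p k).2) hs hF hu hw)).2
  have h1 : ∑ k, ⟪w, σ' • (p k).2⟫ * ⟪μ k + σ • (p k).1, u⟫
      = σ' * (σ * crossForm p u w + ∑ k, ⟪w, (p k).2⟫ * ⟪μ k, u⟫) := by
    simp_rw [crossForm, Finset.mul_sum, ← Finset.sum_add_distrib, Finset.mul_sum]
    refine Finset.sum_congr rfl fun k _ => ?_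
    rw [inner_smul_right, inner_add_left, real_inner_smul_left,
      real_inner_comm (p k).1 u]
    ring
  rw [h1]
  gcongr

/-- The samples for which the Gram form is at least `c` and the cross form is at most `r`. -/
def goodSamples (K : Type*) [Fintype K] (n l : ℕ) (c r : ℝ) :
    Set (K → EuclideanSpace ℝ (Fin n) × EuclideanSpace ℝ (Fin l)) :=
  {q | (∀ u : EuclideanSpace ℝ (Fin n), ‖u‖ = 1 → c ≤ ∑ k, ⟪u, (q k).1⟫ ^ 2) ∧
    ∀ (u : EuclideanSpace ℝ (Fin n)) (w : EuclideanSpace ℝ (Fin l)), ‖u‖ = 1 → ‖w‖ = 1 →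
      ∑ k, ⟪w, (q k).2⟫ * ⟪(q k).1, u⟫ ≤ r}

/-- Supplies measurability, which the uncountable intersection over unit vectors does not give
directly. -/
lemma isClosed_goodSamples (c r : ℝ) : IsClosed (goodSamples K n l c r) := by
  simp only [goodSamples, Set.ofPred_and, Set.ofPred_forall]
  refine IsClosed.inter ?_ ?_
  · exact isClosed_iInter fun u => isClosed_iInter fun _ => isClosed_le (by fun_prop) (by fun_prop)
  · exact isClosed_iInter fun u => isClosed_iInter fun w => isClosed_iInter fun _ =>
      isClosed_iInter fun _ => isClosed_le (by fun_prop) (by fun_prop)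

/-- On good samples the least-squares error is at most `r / c`. -/
lemma isUnit_and_norm_sub_le {c r : ℝ} (hc : 0 < c) (hr : 0 ≤ r)
    {q : K → EuclideanSpace ℝ (Fin n) × EuclideanSpace ℝ (Fin l)}
    (hq : q ∈ goodSamples K n l c r) (Θ : Matrix (Fin l) (Fin n) ℝ)
    (y : K → EuclideanSpace ℝ (Fin l))
    (hy : ∀ k, y k = Matrix.toEuclideanLin Θ (q k).1 + (q k).2) :
    IsUnit (∑ k, Matrix.vecMulVec (q k).1.ofLp (q k).1.ofLp) ∧
      ‖(∑ k, Matrix.vecMulVec (y k).ofLp (q k).1.ofLp)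
        * (∑ k, Matrix.vecMulVec (q k).1.ofLp (q k).1.ofLp)⁻¹ - Θ‖ ≤ r / c := by
  set S := ∑ k, Matrix.vecMulVec (q k).1.ofLp (q k).1.ofLp
  set E := ∑ k, Matrix.vecMulVec (q k).2.ofLp (q k).1.ofLp
  obtain ⟨hS, hSn⟩ := isUnit_and_norm_inv_le (S := S) hc fun u hu => by
    rw [inner_toEuclideanLin_sum_vecMulVec]
    refine (hq.1 u hu).trans_eq (Finset.sum_congr rfl fun k _ => ?_)
    rw [real_inner_comm u, sq]
  have hE : ‖E‖ ≤ r := opNorm_le_of_inner_le E hr fun u w hu hw => by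
    rw [inner_toEuclideanLin_sum_vecMulVec]; exact hq.2 u w hu hw
  refine ⟨hS, ?_⟩
  have hdet := (Matrix.isUnit_iff_isUnit_det S).1 hS
  have h1 : ∑ k, Matrix.vecMulVec (y k).ofLp (q k).1.ofLp = Θ * S + E := by
    simp only [S, E, Matrix.mul_sum, ← Finset.sum_add_distrib]
    refine Finset.sum_congr rfl fun k _ => ?_
    rw [hy k, Matrix.mul_vecMulVec, ← Matrix.add_vecMulVec]
    rfl
  rw [h1, Matrix.add_mul, Matrix.mul_assoc, Matrix.mul_nonsing_inv S hdet, Matrix.mul_one, add_sub_cancel_left]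
  calc ‖E * S⁻¹‖ ≤ ‖E‖ * ‖S⁻¹‖ := Matrix.l2_opNorm_mul E S⁻¹
    _ ≤ r * (1 / c) := by gcongr
    _ = r / c := by ring

end

/-! ### Numerical constants and the union bound. -/

section

variable {n l : ℕ} {K : Type*} [Fintype K]

lemma pairLaw_map_fst : (pairLaw K n l).map (fun p k => (p k).1)
    = Measure.pi fun _ : K => stdGaussian (EuclideanSpace ℝ (Fin n)) := by
  have h := Measure.pi_map_pi (ι := K) (f := fun _ => Prod.fst)
    (μ := fun _ => (stdGaussian (EuclideanSpace ℝ (Fin n))).prod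
      (stdGaussian (EuclideanSpace ℝ (Fin l))))
    (hμ := fun _ => by simp only [Measure.map_fst_prod, measure_univ, one_smul]; infer_instance)
    (fun _ => measurable_fst.aemeasurable)
  simpa only [Measure.map_fst_prod, measure_univ, one_smul] using h

lemma pairLaw_map_snd : (pairLaw K n l).map (fun p k => (p k).2)
    = Measure.pi fun _ : K => stdGaussian (EuclideanSpace ℝ (Fin l)) := by
  have h := Measure.pi_map_pi (ι := K) (f := fun _ => Prod.snd)
    (μ := fun _ => (stdGaussian (EuclideanSpace ℝ (Fin n))).prod
      (stdGaussian (EuclideanSpace ℝ (Fin l))))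
    (hμ := fun _ => by simp only [Measure.map_snd_prod, measure_univ, one_smul]; infer_instance)
    (fun _ => measurable_snd.aemeasurable)
  simpa only [Measure.map_snd_prod, measure_univ, one_smul] using h

/-- An inequality is enough for the union bound, and it holds without measurability of the
exceptional set. -/
lemma pairLaw_fst_le (s : Set (K → EuclideanSpace ℝ (Fin n))) :
    pairLaw K n l {p | (fun k => (p k).1) ∈ s}
      ≤ (Measure.pi fun _ : K => stdGaussian (EuclideanSpace ℝ (Fin n))) s := by
  rw [← pairLaw_map_fst (l := l)]
  exact Measure.le_map_apply (Measurable.aemeasurable (by fun_prop)) s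

lemma pairLaw_snd_le (s : Set (K → EuclideanSpace ℝ (Fin l))) :
    pairLaw K n l {p | (fun k => (p k).2) ∈ s}
      ≤ (Measure.pi fun _ : K => stdGaussian (EuclideanSpace ℝ (Fin l))) s := by
  rw [← pairLaw_map_snd (n := n)]
  exact Measure.le_map_apply (Measurable.aemeasurable (by fun_prop)) s

lemma eexp_neg_log {x : ℝ} (hx : 0 < x) : eexp (-Real.log x) = ENNReal.ofReal x⁻¹ := by
  rw [eexp, Real.exp_neg, Real.exp_log hx]

lemma log_two_le : Real.log 2 ≤ 1 := by linarith [Real.log_two_lt_d9]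

lemma log_five_le : Real.log 5 ≤ 2 := by
  rw [Real.log_le_iff_le_exp (by norm_num)]
  have h := Real.exp_one_gt_d9
  calc (5 : ℝ) ≤ 2.7182818283 ^ 2 := by norm_num
    _ ≤ Real.exp 1 ^ 2 := by gcongr
    _ = Real.exp 2 := by rw [← Real.exp_nat_mul]; norm_num

/-- Numerical inequality behind the tail bound for the product of two Gaussian matrices. -/
lemma four_thirds_mul_add_log_four_le {a b : ℝ} (ha : 1 ≤ a) (hb : a + 2 ≤ b) :
    4 / 3 * a + Real.log 4 ≤ 9 / 4 * √(a * b / 2) := by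
  have h4 : Real.log 4 ≤ 7 / 5 := by
    rw [show (4 : ℝ) = 2 ^ 2 by norm_num, Real.log_pow]
    have := Real.log_two_lt_d9
    push_cast; linarith
  have h : 4 / 9 * (4 / 3 * a + 7 / 5) ≤ √(a * b / 2) := by
    apply Real.le_sqrt_of_sq_le
    nlinarith [mul_le_mul_of_nonneg_left hb (by linarith : 0 ≤ a)]
  linarith

/-- With `θ² = D a / (2N) ≤ 1/4`, the logarithmic term costs at most `D a / 3`, while `θ √(N D b) =
D √(a b / 2)`. It remains to compare the coefficients of `D`, where `b ≥ a + 2` leaves room for `log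
4`. -/
lemma crossForm_exponent_le {N D a b : ℝ} (hD : 1 ≤ D) (ha : 1 ≤ a) (hb : a + 2 ≤ b)
    (hN : 2 * D * a ≤ N) :
    D * Real.log 4 - N * Real.log (1 - √(D * a / (2 * N)) ^ 2) / 2
      - √(D * a / (2 * N)) * (9 / 16 * (4 * √(N * D * b))) ≤ -a := by
  have hN0 : 0 < N := by nlinarith
  have hDa : 0 < D * a := by positivity
  rw [Real.sq_sqrt (by positivity)]
  have hx : D * a / (2 * N) ≤ 1 / 4 := by
    rw [div_le_iff₀ (by positivity)]; linarith
  have hlog := Real.one_sub_inv_le_log_of_pos (x := 1 - D * a / (2 * N)) (by linarith)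
  set x := D * a / (2 * N)
  have hx0 : 0 ≤ x := by positivity
  have h1 : -(4 / 3 * x) ≤ Real.log (1 - x) := by
    refine le_trans ?_ hlog
    have : (1 - x)⁻¹ ≤ 1 + 4 / 3 * x := by
      rw [inv_le_iff_one_le_mul₀ (by linarith)]
      nlinarith
    linarith
  have hNx : N * x = D * a / 2 := by simp only [x]; field_simp
  have h2 : √x * √(N * D * b) = D * √(a * b / 2) := by
    rw [← Real.sqrt_mul hx0, ← mul_assoc, ← mul_assoc, mul_comm x, hNx,
      show D * a / 2 * D * b = D ^ 2 * (a * b / 2) by ring, Real.sqrt_mul (by positivity),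
      Real.sqrt_sq (by linarith)]
  have h3 := four_thirds_mul_add_log_four_le ha hb
  have h4 := mul_le_mul_of_nonneg_left h1 hN0.le
  have h5 := mul_le_mul_of_nonneg_left h3 (by linarith : 0 ≤ D)
  have h6 : √x * (9 / 16 * (4 * √(N * D * b))) = 9 / 4 * (√x * √(N * D * b)) := by ring
  rw [h6, h2]
  nlinarith [mul_le_mul_of_nonneg_right hD (by linarith : 0 ≤ a)]

lemma sum_sum_sq_le {N ν : ℝ} (hN : N = Fintype.card K) (μ : K → EuclideanSpace ℝ (Fin n))
    (hμ : ∀ k, ‖μ k‖ ≤ ν) : ∑ i, ∑ k, (μ k) i ^ 2 ≤ N * ν ^ 2 := by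
  rw [Finset.sum_comm]
  simp_rw [← EuclideanSpace.real_norm_sq_eq]
  calc _ ≤ ∑ _k : K, ν ^ 2 := Finset.sum_le_sum fun k _ => by gcongr; exact hμ k
    _ = _ := by rw [hN]; simp

/-- The affine map turning standard Gaussian pairs into features and noises. -/
noncomputable def affineSamples (μ : K → EuclideanSpace ℝ (Fin n)) (σ σ' : ℝ)
    (p : K → EuclideanSpace ℝ (Fin n) × EuclideanSpace ℝ (Fin l)) :
    K → EuclideanSpace ℝ (Fin n) × EuclideanSpace ℝ (Fin l) :=
  fun k => (μ k + σ • (p k).1, σ' • (p k).2)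

/-- The deterministic part: outside the exceptional events, the samples are good. -/
lemma affineSamples_mem_goodSamples {N σ σ' r s : ℝ} (hn : 0 < n)
    (hN0 : 0 < N) (hσ : 0 < σ) (hσ' : 0 ≤ σ') (hs : 0 ≤ s) (μ : K → EuclideanSpace ℝ (Fin n))
    (p : K → EuclideanSpace ℝ (Fin n) × EuclideanSpace ℝ (Fin l))
    (hG : ∀ u : EuclideanSpace ℝ (Fin n), ‖u‖ = 1 → 253 / 1000 * N ≤ ∑ k, ⟪(p k).1, u⟫ ^ 2)
    (hF : ∑ i, ‖∑ k, (μ k) i • (p k).1‖ ^ 2 ≤ (319 / 5000 * (N * σ)) ^ 2)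
    (hF' : ∑ i, ‖∑ k, (μ k) i • (p k).2‖ ^ 2 ≤ s ^ 2)
    (hr : ∀ (u : EuclideanSpace ℝ (Fin n)) (w : EuclideanSpace ℝ (Fin l)),
      ‖u‖ = 1 → ‖w‖ = 1 → crossForm p u w ≤ r) :
    affineSamples μ σ σ' p ∈ goodSamples K n l (N * σ ^ 2 / 8 * lambdaMin (1 + (4 / (N * σ ^ 2)) •
      ∑ k, Matrix.vecMulVec (μ k).ofLp (μ k).ofLp)) (σ' * (σ * r + s)) := by
  refine ⟨fun u hu => ?_, fun u w hu hw =>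
    sum_inner_mul_inner_le hσ.le hσ' hs μ p hu hw (hr u w hu hw) hF'⟩
  refine le_trans ?_ (le_sum_inner_sq hN0.le hσ.le μ (fun k => (p k).1) hu (hG u hu) hF)
  have hH : (1 + (4 / (N * σ ^ 2)) •
      ∑ k, Matrix.vecMulVec (μ k).ofLp (μ k).ofLp).IsHermitian := by
    refine Matrix.isHermitian_one.add ?_
    rw [Matrix.IsHermitian, Matrix.conjTranspose_smul, isHermitian_sum_vecMulVec μ]
    simp
  have h1 := (le_lambdaMin_iff hn hH _).1 le_rfl u hu
  rw [inner_toEuclideanLin_one_add_smul _ _ hu, inner_toEuclideanLin_sum_vecMulVec] at h1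
  have h2 : ∑ k, ⟪u, μ k⟫ * ⟪μ k, u⟫ = ∑ k, ⟪μ k, u⟫ ^ 2 :=
    Finset.sum_congr rfl fun k _ => by rw [real_inner_comm, sq]
  rw [h2] at h1
  calc _ ≤ N * σ ^ 2 / 8 * (1 + 4 / (N * σ ^ 2) * ∑ k, ⟪μ k, u⟫ ^ 2) := by gcongr
    _ = _ := by field_simp; ring

/-- Ensures that the lower bound on the Gram form, and the denominator in the final estimate, are
positive. -/
lemma one_le_lambdaMin (hn : 0 < n) {c : ℝ} (hc : 0 ≤ c) (μ : K → EuclideanSpace ℝ (Fin n)) :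
    1 ≤ lambdaMin (1 + c • ∑ k, Matrix.vecMulVec (μ k).ofLp (μ k).ofLp) := by
  have hH : (1 + c • ∑ k, Matrix.vecMulVec (μ k).ofLp (μ k).ofLp).IsHermitian := by
    refine Matrix.isHermitian_one.add ?_
    rw [Matrix.IsHermitian, Matrix.conjTranspose_smul, isHermitian_sum_vecMulVec μ]
    simp
  refine (le_lambdaMin_iff hn hH 1).2 fun u hu => ?_
  rw [inner_toEuclideanLin_one_add_smul _ _ hu, inner_toEuclideanLin_sum_vecMulVec]
  have : 0 ≤ ∑ k, ⟪u, μ k⟫ * ⟪μ k, u⟫ := Finset.sum_nonneg fun k _ => by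
    rw [real_inner_comm]; exact mul_self_nonneg _
  nlinarith

lemma add_le_sq_sqrt_add {a b c : ℝ} (ha : 0 ≤ a) (hb : 0 ≤ b) (hc : 0 ≤ c) :
    a + c ^ 2 * b ≤ (√a + c * √b) ^ 2 := by
  have e : 0 ≤ c * (√a * √b) := by positivity
  rw [add_sq, mul_pow, Real.sq_sqrt ha, Real.sq_sqrt hb]
  linarith

lemma measure_union_five_le {Ω : Type*} [MeasurableSpace Ω] (P : Measure Ω)
    {s₁ s₂ s₃ s₄ s₅ : Set Ω} {c₁ c₂ c₃ c₄ c₅ : ENNReal} (h₁ : P s₁ ≤ c₁) (h₂ : P s₂ ≤ c₂)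
    (h₃ : P s₃ ≤ c₃) (h₄ : P s₄ ≤ c₄) (h₅ : P s₅ ≤ c₅) :
    P (s₁ ∪ s₂ ∪ s₃ ∪ s₄ ∪ s₅) ≤ c₁ + c₂ + c₃ + c₄ + c₅ :=
  (measure_union_le _ _).trans <| add_le_add ((measure_union_le _ _).trans <| add_le_add
    ((measure_union_le _ _).trans <| add_le_add ((measure_union_le _ _).trans <|
      add_le_add h₁ h₂) h₃) h₄) h₅

/-- The probability that the samples are not good. -/
lemma pairLaw_affineSamples_notMem_le {N σ σ' ν δ : ℝ} (hn : 0 < n) (hN : N = Fintype.card K)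
    (hσ : 0 < σ) (hσ' : 0 ≤ σ') (hν : 0 ≤ ν) (μ : K → EuclideanSpace ℝ (Fin n))
    (hμ : ∀ k, ‖μ k‖ ≤ ν) (hδ : 0 < δ) (hδ4 : δ < 1 / 4)
    (h1 : t1 n δ ≤ N) (h2 : t2 n σ ν δ ≤ N) (h3 : t3 n l δ ≤ N) :
    pairLaw K n l {p | affineSamples μ σ σ' p ∉ goodSamples K n l
      (N * σ ^ 2 / 8 * lambdaMin (1 + (4 / (N * σ ^ 2)) •
        ∑ k, Matrix.vecMulVec (μ k).ofLp (μ k).ofLp)) (√N * C1 n l σ σ' ν δ / 8)}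
      ≤ ENNReal.ofReal (4 * δ) := by
  have hn1 : (1 : ℝ) ≤ n := by exact_mod_cast hn
  have hl0 : (0 : ℝ) ≤ l := Nat.cast_nonneg l
  set L := Real.log (2 / δ) with hL
  set a := Real.log (1 / δ) with ha
  set b := Real.log (9 / δ) with hb
  have ha1 : 1 ≤ a := by
    rw [ha, Real.le_log_iff_exp_le (by positivity)]
    have : (4 : ℝ) ≤ 1 / δ := by rw [le_div_iff₀ hδ]; linarith
    linarith [Real.exp_one_lt_d9]
  have hab : a + 2 ≤ b := by
    have h9 : b = a + Real.log 9 := by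
      rw [ha, hb, ← Real.log_mul (by positivity) (by norm_num)]; congr 1; ring
    have : 2 ≤ Real.log 9 := by
      rw [Real.le_log_iff_exp_le (by norm_num)]
      have h := Real.exp_one_lt_d9
      calc Real.exp 2 = Real.exp 1 ^ 2 := by rw [← Real.exp_nat_mul]; norm_num
        _ ≤ 2.7182818286 ^ 2 := by gcongr
        _ ≤ 9 := by norm_num
    linarith
  have hL1 : 0 ≤ L := ha1.trans' zero_le_one |>.trans <| by
    rw [ha, hL]; apply Real.log_le_log (by positivity); gcongr; norm_num
  rw [t1] at h1
  rw [t3] at h3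
  have hN0 : 0 < N := by nlinarith
  set D := (n : ℝ) + l
  set r := 4 * √(N * D * b)
  set s := √N * (ν * (√(2 * (l + n)) + 2 * √L))
  have hs : 0 ≤ s := by positivity
  -- The two summands of `C1` are the product term `σ r` and the mixed term `s`.
  have hrs : √N * C1 n l σ σ' ν δ / 8 = σ' * (σ * r + s) := by
    simp only [C1, r, s]
    rw [show N * D * b = N * (D * b) by ring, Real.sqrt_mul hN0.le]
    ring
  rw [hrs]
  set B1 : Set (K → EuclideanSpace ℝ (Fin n)) := {g | n * (8 / 5 * N) ≤ ∑ k, ‖g k‖ ^ 2}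
  set B2 : Set (K → EuclideanSpace ℝ (Fin n)) :=
    {g | ∑ k, ‖g k‖ ^ 2 ≤ n * (8 / 5 * N) ∧ ∃ u : EuclideanSpace ℝ (Fin n),
        ‖u‖ = 1 ∧ ∑ k, ⟪g k, u⟫ ^ 2 < 253 / 1000 * N}
  set B3 : Set (K → EuclideanSpace ℝ (Fin n)) :=
    {g | N * ν ^ 2 * (25 / 24 * (4 * n + 2 * L)) < ∑ i, ‖∑ k, (μ k) i • g k‖ ^ 2}
  set B4 : Set (K → EuclideanSpace ℝ (Fin l)) :=
    {h | N * ν ^ 2 * (2 * (l + n) + 4 * L) < ∑ i, ‖∑ k, (μ k) i • h k‖ ^ 2}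
  set B5 : Set (K → EuclideanSpace ℝ (Fin n) × EuclideanSpace ℝ (Fin l)) :=
    {p | ∃ (u : EuclideanSpace ℝ (Fin n)) (w : EuclideanSpace ℝ (Fin l)),
      ‖u‖ = 1 ∧ ‖w‖ = 1 ∧ r < crossForm p u w}
  have heL : eexp (-L) = ENNReal.ofReal (δ / 2) := by
    rw [hL, eexp_neg_log (by positivity), inv_div]
  have hB1 : pairLaw K n l {p | (fun k => (p k).1) ∈ B1} ≤ ENNReal.ofReal (δ / 2) := by
    refine (pairLaw_fst_le B1).trans ((measure_le_sum_normSq hn hN).trans ?_)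
    rw [← heL]
    apply eexp_mono; linarith
  have hB2 : pairLaw K n l {p | (fun k => (p k).1) ∈ B2} ≤ ENNReal.ofReal δ := by
    refine (pairLaw_fst_le B2).trans ((measure_exists_sum_inner_sq_lt hn hN).trans ?_)
    -- From `N ≥ 8n + 16L`: `8 · 0.2529 ≥ 39/20` and `16 · 0.2529 ≥ 1`.
    calc _ ≤ 2 * eexp (-L) := by
          gcongr 2 * ?_
          apply eexp_mono; linarith
      _ = ENNReal.ofReal δ := by
          rw [heL, show (2 : ENNReal) = ENNReal.ofReal 2 by simp,
            ← ENNReal.ofReal_mul (by norm_num)]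
          congr 1; ring
  have hV := sum_sum_sq_le hN μ hμ
  -- For `q = 24/25` the exponent is `-(2n + L) + n log 5`, and `log 5 ≤ 2`.
  have hB3 : pairLaw K n l {p | (fun k => (p k).1) ∈ B3} ≤ ENNReal.ofReal (δ / 2) := by
    refine (pairLaw_fst_le B3).trans ((measure_lt_sum_normSq_sum (q := 24 / 25)
      (fun k i => (μ k) i) (by positivity) hV (by norm_num) (by norm_num)).trans ?_)
    rw [← heL]
    apply eexp_mono
    have : Real.log (1 - 24 / 25) = -(2 * Real.log 5) := by
      rw [show (1 - 24 / 25 : ℝ) = (5 ^ 2)⁻¹ by norm_num, Real.log_inv, Real.log_pow]; norm_num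
    rw [this]
    nlinarith [log_five_le]
  -- For `q = 1/2` the exponent is `-((l + n)/2 + L) + l (log 2)/2`.
  have hB4 : pairLaw K n l {p | (fun k => (p k).2) ∈ B4} ≤ ENNReal.ofReal (δ / 2) := by
    refine (pairLaw_snd_le B4).trans ((measure_lt_sum_normSq_sum (q := 1 / 2)
      (fun k i => (μ k) i) (by positivity) hV (by norm_num) (by norm_num)).trans ?_)
    rw [← heL]
    apply eexp_mono
    have : Real.log (1 - 1 / 2) = -Real.log 2 := by
      rw [← Real.log_inv]; norm_num
    rw [this]
    nlinarith [log_two_le]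
  have hB5 : pairLaw K n l B5 ≤ ENNReal.ofReal δ := by
    have hD1 : 1 ≤ D := by simp only [D]; linarith
    have hθ : √(D * a / (2 * N)) ^ 2 < 1 := by
      rw [Real.sq_sqrt (by positivity), div_lt_one (by positivity)]; nlinarith
    refine (measure_exists_lt_crossForm (Real.sqrt_nonneg (D * a / (2 * N))) hθ).trans ?_
    have he := eexp_neg_log (x := 1 / δ) (by positivity)
    rw [one_div, inv_inv] at he
    rw [← he, ← hN, ← one_div]
    exact eexp_mono (crossForm_exponent_le hD1 ha1 hab h3)
  have hsub : {p | affineSamples μ σ σ' p ∉ goodSamples K n l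
      (N * σ ^ 2 / 8 * lambdaMin (1 + (4 / (N * σ ^ 2)) •
        ∑ k, Matrix.vecMulVec (μ k).ofLp (μ k).ofLp)) (σ' * (σ * r + s))} ⊆
      {p | (fun k => (p k).1) ∈ B1} ∪ {p | (fun k => (p k).1) ∈ B2} ∪ {p | (fun k => (p k).1) ∈ B3}
        ∪ {p | (fun k => (p k).2) ∈ B4} ∪ B5 := by
    intro p hp
    by_contra hcon
    simp only [Set.mem_union, not_or] at hcon
    obtain ⟨⟨⟨⟨hp1, hp2⟩, hp3⟩, hp4⟩, hp5⟩ := hcon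
    simp only [B1, B2, B3, B4, B5, Set.mem_ofPred_eq, not_le, not_lt, not_and, not_exists]
      at hp1 hp2 hp3 hp4 hp5
    apply hp
    refine affineSamples_mem_goodSamples hn hN0 hσ hσ' hs μ p (fun u hu => hp2 hp1.le u hu)
      (hp3.trans ?_) (hp4.trans ?_) hp5
    · have h2' : 256 * ν ^ 2 * (4 * n + 2 * L) ≤ N * σ ^ 2 := by
        rw [t2, div_pow, div_le_iff₀ (by positivity)] at h2
        refine le_trans ?_ h2
        rw [mul_pow]
        have : 4 * n + 2 * L ≤ (√(4 * n) + √(2 * L)) ^ 2 := by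
          simpa using add_le_sq_sqrt_add (a := 4 * n) (b := 2 * L) (by positivity) (by positivity)
            zero_le_one
        calc 256 * ν ^ 2 * (4 * n + 2 * L) = (16 * ν) ^ 2 * (4 * n + 2 * L) := by ring
          _ ≤ _ := by gcongr
      -- The constant `319/5000` is `√(25/6144)` rounded up.
      calc N * ν ^ 2 * (25 / 24 * (4 * n + 2 * L))
          = 25 / 6144 * N * (256 * ν ^ 2 * (4 * n + 2 * L)) := by ring
        _ ≤ 25 / 6144 * N * (N * σ ^ 2) := by gcongr
        _ ≤ _ := by nlinarith [mul_nonneg hN0.le (mul_nonneg hN0.le (sq_nonneg σ))]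
    · have : 2 * (l + n) + 4 * L ≤ (√(2 * (l + n)) + 2 * √L) ^ 2 := by
        have h := add_le_sq_sqrt_add (a := 2 * (l + n)) (by positivity) hL1 zero_le_two
        linarith
      calc N * ν ^ 2 * (2 * (l + n) + 4 * L) ≤ N * ν ^ 2 * (√(2 * (l + n)) + 2 * √L) ^ 2 := by
            gcongr
        _ = s ^ 2 := by simp only [s]; rw [mul_pow, Real.sq_sqrt hN0.le]; ring
  -- The five bounds add up to `δ/2 + δ + δ/2 + δ/2 + δ = 7δ/2`.
  refine ((measure_mono hsub).trans (measure_union_five_le _ hB1 hB2 hB3 hB4 hB5)).trans ?_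
  rw [← ENNReal.ofReal_add, ← ENNReal.ofReal_add, ← ENNReal.ofReal_add, ← ENNReal.ofReal_add]
  · apply ENNReal.ofReal_le_ofReal; linarith
  all_goals positivity

end

/-! ### Transfer from standard Gaussian pairs to the data model. -/

section

/-- Comparison of characteristic functions, which also covers the degenerate case `σ = 0` where
there is no density. -/
lemma multivariateGaussian_sq_smul_one {d : ℕ} (μ : EuclideanSpace ℝ (Fin d)) {σ : ℝ}
    (hσ : 0 ≤ σ) :
    multivariateGaussian μ (σ ^ 2 • (1 : Matrix (Fin d) (Fin d) ℝ))
      = (stdGaussian (EuclideanSpace ℝ (Fin d))).map (fun x => μ + σ • x) := by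
  refine Measure.ext_of_charFun ?_
  ext z
  rw [charFun_multivariateGaussian (Matrix.PosSemidef.one.smul (sq_nonneg σ))]
  have h1 : charFun ((stdGaussian (EuclideanSpace ℝ (Fin d))).map (fun x => μ + σ • x)) z
      = Complex.exp (⟪μ, z⟫ * Complex.I) *
        charFun (stdGaussian (EuclideanSpace ℝ (Fin d))) (σ • z) := by
    rw [charFun_apply, charFun_apply, integral_map (by fun_prop) (by fun_prop),
      ← integral_const_mul]
    congr 1; ext x
    rw [← Complex.exp_add, inner_add_left, real_inner_smul_left, real_inner_smul_right]
    congr 1; push_cast; ring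
  rw [h1, charFun_stdGaussian, ← Complex.exp_add]
  congr 1
  have h2 : z.ofLp ⬝ᵥ (σ ^ 2 • (1 : Matrix (Fin d) (Fin d) ℝ)).mulVec z.ofLp
      = (σ * ‖z‖) ^ 2 := by
    rw [Matrix.smul_mulVec, Matrix.one_mulVec, dotProduct_smul, mul_pow,
      EuclideanSpace.real_norm_sq_eq]
    simp [dotProduct, sq]
  rw [h2, norm_smul, Real.norm_of_nonneg hσ, real_inner_comm]
  push_cast
  ring

lemma crossSum_eq_sum {m p q : ℕ} (u : Fin m → ℕ+ → EuclideanSpace ℝ (Fin p))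
    (v : Fin m → ℕ+ → EuclideanSpace ℝ (Fin q)) (t : ℕ+) :
    crossSum u v t = ∑ k : Fin m × Finset.Icc (1 : ℕ+) t,
      Matrix.vecMulVec (u k.1 k.2).ofLp (v k.1 k.2).ofLp := by
  rw [crossSum, Fintype.sum_prod_type]
  refine Finset.sum_congr rfl fun i _ => ?_
  rw [← Finset.sum_coe_sort]

lemma card_prod_Icc (m : ℕ) (t : ℕ+) :
    (Fintype.card (Fin m × Finset.Icc (1 : ℕ+) t) : ℝ) = m * t := by
  simp

/-- The law of the samples in the data model. -/
lemma GaussianModel.map_samples {Ω : Type*} [MeasurableSpace Ω] {P : Measure Ω}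
    [IsProbabilityMeasure P] {m n l : ℕ} {Θ : Matrix (Fin l) (Fin n) ℝ}
    {μ : Fin m → ℕ+ → EuclideanSpace ℝ (Fin n)} {σx ση μhat : ℝ}
    {x : Fin m → ℕ+ → Ω → EuclideanSpace ℝ (Fin n)} {η y : Fin m → ℕ+ → Ω → EuclideanSpace ℝ (Fin l)}
    (hmodel : GaussianModel P Θ μ σx ση μhat x η y) (hσx : 0 ≤ σx) (hση : 0 ≤ ση)
    {K : Type*} [Fintype K] {e : K → Fin m × ℕ+} (he : Function.Injective e) :
    P.map (fun ω k => (x (e k).1 (e k).2 ω, η (e k).1 (e k).2 ω))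
      = (pairLaw K n l).map (affineSamples (fun k => μ (e k).1 (e k).2) σx ση) := by
  have hm : ∀ k, AEMeasurable (fun ω => (x (e k).1 (e k).2 ω, η (e k).1 (e k).2 ω)) P := fun k =>
    (hmodel.law_feature _ _).aemeasurable.prodMk (hmodel.law_noise _ _).aemeasurable
  have h1 := (iIndepFun_iff_map_fun_eq_pi_map hm).1 (hmodel.indep_pairs.precomp he)
  have h2 : ∀ k, P.map (fun ω => (x (e k).1 (e k).2 ω, η (e k).1 (e k).2 ω))
      = ((stdGaussian (EuclideanSpace ℝ (Fin n))).prod (stdGaussian (EuclideanSpace ℝ (Fin l)))).map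
        (fun p => (μ (e k).1 (e k).2 + σx • p.1, ση • p.2)) := by
    intro k
    rw [(indepFun_iff_map_prod_eq_prod_map_map (hmodel.law_feature _ _).aemeasurable
      (hmodel.law_noise _ _).aemeasurable).1 (hmodel.indep_feature_noise _ _),
      (hmodel.law_feature _ _).map_eq, (hmodel.law_noise _ _).map_eq,
      multivariateGaussian_sq_smul_one _ hσx, multivariateGaussian_sq_smul_one _ hση,
      Measure.map_prod_map _ _ (by fun_prop) (by fun_prop)]
    simp only [zero_add]
    rfl
  rw [h1]
  simp_rw [h2]
  exact (Measure.pi_map_pi fun k => by fun_prop).symm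

end

end DistEst

theorem theorem2 {Ω : Type*} [MeasurableSpace Ω] (P : Measure Ω) [IsProbabilityMeasure P]
    {m n l : ℕ} (hm : 0 < m) (hn : 0 < n)
    (Θ : Matrix (Fin l) (Fin n) ℝ) (μ : Fin m → ℕ+ → EuclideanSpace ℝ (Fin n))
    (σx ση μhat : ℝ) (hσx : 0 < σx) (hση : 0 ≤ ση)
    (x : Fin m → ℕ+ → Ω → EuclideanSpace ℝ (Fin n))
    (η y : Fin m → ℕ+ → Ω → EuclideanSpace ℝ (Fin l))
    (hmodel : DistEst.GaussianModel P Θ μ σx ση μhat x η y)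
    (δ : ℝ) (hδ : 0 < δ) (t : ℕ+)
    (ht : (1 / (m : ℝ)) * max (DistEst.t1 n δ)
      (max (DistEst.t2 n σx μhat δ) (DistEst.t3 n l δ)) ≤ (t : ℝ)) :
    1 - 4 * δ ≤ P.real {ω |
      IsUnit (DistEst.crossSum (fun i j => x i j ω) (fun i j => x i j ω) t) ∧
      ‖DistEst.globalEstimate (fun i j => x i j ω) (fun i j => y i j ω) t - Θ‖ ≤
        DistEst.C1 n l σx ση μhat δ /
          (√((m : ℝ) * (t : ℝ)) * σx ^ 2 *
            DistEst.lambdaMin (1 + DistEst.meanGram μ σx t))} := by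
  -- For `δ ≥ 1/4` the left side is nonpositive; otherwise `log (1/δ) ≥ 1`, as the tail bounds
  -- require.
  rcases le_or_gt (1 / 4) δ with hδ4 | hδ4
  · exact le_trans (by linarith) measureReal_nonneg
  have hm0 : (0 : ℝ) < m := by exact_mod_cast hm
  have ht0 : (0 : ℝ) < t := by exact_mod_cast t.pos
  set K := Fin m × Finset.Icc (1 : ℕ+) t
  set N : ℝ := m * t with hN
  have hN0 : 0 < N := by positivity
  have hNK : N = Fintype.card K := (DistEst.card_prod_Icc m t).symm
  set e : K → Fin m × ℕ+ := fun k => (k.1, k.2)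
  have he : Function.Injective e := fun k k' h => by
    simp only [e, Prod.mk.injEq] at h
    exact Prod.ext h.1 (Subtype.ext h.2)
  have hμ : ∀ k : K, ‖μ (e k).1 (e k).2‖ ≤ μhat := fun k =>
    hmodel.sup_mean.1 ⟨e k, rfl⟩
  have hμ0 : 0 ≤ μhat := (norm_nonneg _).trans (hmodel.sup_mean.1 ⟨(⟨0, hm⟩, 1), rfl⟩)
  rw [one_div, inv_mul_le_iff₀ hm0, ← hN, max_le_iff, max_le_iff] at ht
  set M := ∑ k : K, Matrix.vecMulVec (μ (e k).1 (e k).2).ofLp (μ (e k).1 (e k).2).ofLp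
  set lam := DistEst.lambdaMin (1 + (4 / (N * σx ^ 2)) • M)
  have hlam : 1 ≤ lam := DistEst.one_le_lambdaMin hn (by positivity) fun k : K => μ (e k).1 (e k).2
  have hmean : DistEst.meanGram μ σx t = (4 / (N * σx ^ 2)) • M := by
    rw [DistEst.meanGram, DistEst.crossSum_eq_sum]
  rw [hmean]
  set G := DistEst.goodSamples K n l (N * σx ^ 2 / 8 * lam)
    (√N * DistEst.C1 n l σx ση μhat δ / 8)
  set Φ : Ω → K → EuclideanSpace ℝ (Fin n) × EuclideanSpace ℝ (Fin l) :=
    fun ω k => (x (e k).1 (e k).2 ω, η (e k).1 (e k).2 ω)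
  have hΦ : AEMeasurable Φ P := aemeasurable_pi_lambda _ fun k =>
    (hmodel.law_feature _ _).aemeasurable.prodMk (hmodel.law_noise _ _).aemeasurable
  have hG : MeasurableSet G := (DistEst.isClosed_goodSamples _ _).measurableSet
  have hbad : P (Φ ⁻¹' Gᶜ) ≤ ENNReal.ofReal (4 * δ) := by
    rw [← Measure.map_apply_of_aemeasurable hΦ hG.compl,
      hmodel.map_samples hσx.le hση he, Measure.map_apply _ hG.compl]
    · exact DistEst.pairLaw_affineSamples_notMem_le hn hNK hσx hση hμ0 _ hμ hδ hδ4
        ht.1 ht.2.1 ht.2.2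
    · unfold DistEst.affineSamples; fun_prop
  have hgood : 1 - 4 * δ ≤ P.real (Φ ⁻¹' G) := by
    have h1 : P.real (Φ ⁻¹' Gᶜ) ≤ 4 * δ := ENNReal.toReal_le_of_le_ofReal (by positivity) hbad
    have h2 := measureReal_union_le (μ := P) (Φ ⁻¹' G) (Φ ⁻¹' Gᶜ)
    rw [Set.preimage_compl, Set.union_compl_self, probReal_univ, ← Set.preimage_compl] at h2
    linarith
  refine hgood.trans (measureReal_mono fun ω hω => ?_)
  have hC : 0 ≤ DistEst.C1 n l σx ση μhat δ := by unfold DistEst.C1; positivity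
  have hres := DistEst.isUnit_and_norm_sub_le (by positivity) (by positivity) hω Θ
    (fun k => y (e k).1 (e k).2 ω) (fun k => hmodel.label _ _ ω)
  simp only [Set.mem_ofPred_eq, DistEst.globalEstimate, DistEst.crossSum_eq_sum]
  refine ⟨hres.1, hres.2.trans_eq ?_⟩
  -- The quotient `(√N C₁ / 8) / (N σ_x² lam / 8)` simplifies to the claimed bound through `√N · √N
  -- = N`.
  have hsq : √N * √N = N := Real.mul_self_sqrt hN0.le
  have hs0 : 0 < √N := Real.sqrt_pos.2 hN0
  rw [div_eq_div_iff (by positivity) (by positivity)]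
  linear_combination (DistEst.C1 n l σx ση μhat δ * σx ^ 2 * lam / 8) * hsq
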